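/- Let $a>0$, $\mu>0$. Let $A_1,A_2,\dots$ be i.i.d. positive interarrival times with distribution $F$ and Laplace–Stieltjes transform $\phi(s)=\int e^{-st}\,dF(t)$, and let $C_1,C_2,\dots$ be i.i.d. exponentially distributed with mean $1/\mu$, independent of the $A_i$. Put $T_i=A_1+\dots+A_i$ and $N(t)=\#\{i\ge 1: T_i\le t\}$. For initial surplus $x>0$ let $U$ be the surplus process $$U(t)=x-t+\sum_{i=1}^{N(t)}\bigl(C_i+aU(T_i-)\bigr),\qquad t\ge 0,$$ let $\tau_x=\inf\{t\ge 0: U(t)=0\}$ (with $\inf\emptyset=\infty$), and let $\rho(s)=\int_0^\infty e^{-sx}\,\mathbb P_x(\tau_x<\infty)\,dx$, which converges absolutely for complex $s$ with $\operatorname{Re}s>0$. Define $$J(s)=\phi(s)\frac{\mu}{\mu(1+a)-s},\qquad H(s)=\frac{1-\phi(s)}{s}-\phi(s)\frac{\mu}{\mu(1+a)-s}\,\rho(\mu).$$ Then for every complex $s$ with $\operatorname{Re}s>0$ and $s\ne\mu(1+a)^{j+1}$, $j=0,1,2,\dots$, $$\rho(s)=\sum_{k=0}^\infty\ \prod_{j=0}^{k-1}J\Bigl(\frac{s}{(1+a)^j}\Bigr)\,H\Bigl(\frac{s}{(1+a)^k}\Bigr),$$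 where the series converges absolutely and an empty product equals $1$. At each excluded point $s_0=\mu(1+a)^{j+1}$ the singularity is removable: the sum of the series tends to $\rho(s_0)$ as $s\to s_0$, $s\neq s_0$. Moreover $$\rho(\mu)=\frac{\displaystyle\sum_{k=0}^\infty\Bigl(\prod_{j=0}^{k-1}J\bigl(\tfrac{\mu}{(1+a)^j}\bigr)\Bigr)\frac{1-\phi\bigl(\frac{\mu}{(1+a)^k}\bigr)}{\frac{\mu}{(1+a)^k}}}{\displaystyle 1+\sum_{k=0}^\infty\Bigl(\prod_{j=0}^{k-1}J\bigl(\tfrac{\mu}{(1+a)^j}\bigr)\Bigr)\phi\bigl(\tfrac{\mu}{(1+a)^k}\bigr)\frac{(1+a)^k}{(1+a)^{k+1}-1}},$$ where both series converge absolutely and the denominator is nonzero. -/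

import Mathlib

open MeasureTheory ProbabilityTheory Filter Topology Set
open scoped NNReal ENNReal

namespace DualRisk

/- Sequences are indexed from `0`: `A i`, `C i`, `arrival A i`, `preJump a A C x i` are the
interarrival time, additive gain, arrival epoch and pre-jump surplus of the `(i + 1)`-st arrival. -/

/-- The arrival epoch `T = A 0 + ⋯ + A i`. -/
def arrival (A : ℕ → ℝ) (i : ℕ) : ℝ := ∑ j ∈ Finset.range (i + 1), A j

/-- The renewal counting process `N(t)`: the number of arrivals in `[0, t]`. -/
noncomputable def count (A : ℕ → ℝ) (t : ℝ) : ℕ := {i : ℕ | arrival A i ≤ t}.ncard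

/-- The surplus `U(T-)` just before an arrival epoch `T`, by recursion: between consecutive arrivals
the surplus decreases at unit rate, and at an arrival it moves from `u` to `(1 + a) u + C`.
See `tendsto_surplus_arrival`. -/
def preJump (a : ℝ) (A C : ℕ → ℝ) (x : ℝ) : ℕ → ℝ
  | 0 => x - A 0
  | i + 1 => (1 + a) * preJump a A C x i + C i - A (i + 1)

/-- The surplus `U(t) = x - t + ∑_{i ≤ N(t)} (C_i + a U(T_i-))` with `U(0) = x`. -/
noncomputable def surplus (a : ℝ) (A C : ℕ → ℝ) (x t : ℝ) : ℝ :=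
  x - t + ∑ i ∈ Finset.range (count A t), (C i + a * preJump a A C x i)

/-- The ruin time `τ_x = inf {t ≥ 0 : U(t) = 0}`, equal to `∞` if there is no such `t`. -/
noncomputable def ruinTime (a : ℝ) (A C : ℕ → ℝ) (x : ℝ) : ℝ≥0∞ :=
  ⨅ (t : ℝ≥0) (_ : surplus a A C x t = 0), (t : ℝ≥0∞)

/-- The ruin probability `R(x) = ℙ_x(τ_x < ∞)`. -/
noncomputable def ruinProb {Ω : Type*} [MeasurableSpace Ω] (P : Measure Ω) (a : ℝ)
    (A C : ℕ → Ω → ℝ) (x : ℝ) : ℝ :=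
  P.real {ω | ruinTime a (fun i => A i ω) (fun i => C i ω) x < ⊤}

/-- The Laplace transform `∫_0^∞ e^{-s x} R(x) dx` of a function on the half-line. -/
noncomputable def laplace (R : ℝ → ℝ) (s : ℂ) : ℂ :=
  ∫ x in Ioi (0 : ℝ), Complex.exp (-s * x) * (R x : ℂ)

/-- The Laplace–Stieltjes transform `φ(s) = ∫ e^{-s t} dF(t)` of a distribution. -/
noncomputable def lst (F : Measure ℝ) (s : ℂ) : ℂ := ∫ t, Complex.exp (-s * t) ∂F

/-- `J(s) = φ(s) μ / (μ (1 + a) - s)`. -/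
noncomputable def J (a μ : ℝ) (F : Measure ℝ) (s : ℂ) : ℂ :=
  lst F s * (μ / (μ * (1 + a) - s))

/-- `H(s) = (1 - φ(s)) / s - φ(s) μ / (μ (1 + a) - s) r`; the constant `r` stands for the value of
the Laplace transform of the ruin probability at `μ`. -/
noncomputable def H (a μ : ℝ) (F : Measure ℝ) (r : ℂ) (s : ℂ) : ℂ :=
  (1 - lst F s) / s - lst F s * (μ / (μ * (1 + a) - s)) * r

/-- The product `∏_{j < k} J(s / (1 + a)^j)`. -/
noncomputable def prodJ (a μ : ℝ) (F : Measure ℝ) (s : ℂ) (k : ℕ) : ℂ :=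
  ∏ j ∈ Finset.range k, J a μ F (s / (1 + a) ^ j)

/-- The `k`-th term `∏_{j < k} J(s / (1 + a)^j) H(s / (1 + a)^k)` of the series. -/
noncomputable def term (a μ : ℝ) (F : Measure ℝ) (r s : ℂ) (k : ℕ) : ℂ :=
  prodJ a μ F s k * H a μ F r (s / (1 + a) ^ k)

/-- The `k`-th term of the series in the numerator of the constant. -/
noncomputable def numTerm (a μ : ℝ) (F : Measure ℝ) (k : ℕ) : ℂ :=
  prodJ a μ F μ k * ((1 - lst F (μ / (1 + a) ^ k)) / (μ / (1 + a) ^ k))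

/-- The `k`-th term of the series in the denominator of the constant. -/
noncomputable def denTerm (a μ : ℝ) (F : Measure ℝ) (k : ℕ) : ℂ :=
  prodJ a μ F μ k * (lst F (μ / (1 + a) ^ k) * ((1 + a) ^ k / ((1 + a) ^ (k + 1) - 1)))

theorem strictMono_arrival {A : ℕ → ℝ} (hA : ∀ i, 0 < A i) : StrictMono (arrival A) :=
  strictMono_nat_of_lt_succ fun i => by
    unfold arrival
    rw [Finset.sum_range_succ _ (i + 1)]
    linarith [hA (i + 1)]

theorem count_eq {A : ℕ → ℝ} (hA : ∀ i, 0 < A i) {n : ℕ} {t : ℝ}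
    (h1 : ∀ i < n, arrival A i ≤ t) (h2 : t < arrival A n) : count A t = n := by
  have : {i : ℕ | arrival A i ≤ t} = (Finset.range n : Set ℕ) := by
    ext i
    simp only [mem_ofPred_eq, Finset.coe_range, mem_Iio]
    refine ⟨fun h => ?_, h1 i⟩
    exact (strictMono_arrival hA).lt_iff_lt.mp (lt_of_le_of_lt h h2)
  rw [count, this, ncard_coe_finset, Finset.card_range]

theorem preJump_eq (a : ℝ) (A C : ℕ → ℝ) (x : ℝ) (n : ℕ) :
    preJump a A C x n =
      x - arrival A n + ∑ i ∈ Finset.range n, (C i + a * preJump a A C x i) := by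
  induction n with
  | zero => simp [preJump, arrival]
  | succ n ih =>
    rw [Finset.sum_range_succ, arrival, Finset.sum_range_succ _ (n + 1), ← arrival]
    rw [preJump]
    linarith

/-- `preJump` is the left limit of the surplus at an arrival epoch. -/
theorem tendsto_surplus_arrival (a : ℝ) {A : ℕ → ℝ} (hA : ∀ i, 0 < A i) (C : ℕ → ℝ) (x : ℝ)
    (n : ℕ) :
    Tendsto (surplus a A C x) (𝓝[<] (arrival A n)) (𝓝 (preJump a A C x n)) := by
  rw [preJump_eq]
  have hT : Tendsto (fun t : ℝ => x - t + ∑ i ∈ Finset.range n, (C i + a * preJump a A C x i))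
      (𝓝[<] (arrival A n))
      (𝓝 (x - arrival A n + ∑ i ∈ Finset.range n, (C i + a * preJump a A C x i))) := by
    apply Tendsto.mono_left _ nhdsWithin_le_nhds
    exact Continuous.tendsto (by fun_prop) _
  refine hT.congr' ?_
  have hev : ∀ᶠ t in 𝓝[<] (arrival A n), ∀ i < n, arrival A i ≤ t := by
    have : ∀ i ∈ Finset.range n, ∀ᶠ t in 𝓝[<] (arrival A n), arrival A i ≤ t := fun i hi => by
      have := strictMono_arrival hA (Finset.mem_range.mp hi)
      filter_upwards [Ioo_mem_nhdsLT this] with t ht using ht.1.le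
    have := (Filter.eventually_all_finset _).mpr this
    simpa using this
  filter_upwards [hev, self_mem_nhdsWithin] with t h1 h2
  rw [surplus, count_eq hA h1 h2]

end DualRisk

/-! The surplus falls at unit rate and an arrival maps `u` to `(1 + a) u + C`. With paths continued
below `0`, ruin means that some pre-arrival value is negative (`ruinTime_lt_top_iff`), so the ruin
probability `R` on the positive half-line depends only on the product law of the two sequences
(`ruinProb_eq`). Conditioning on the first arrival gives an integral equation (`ruinFun_eq`): an
average over the exponential gain, then a convolution with `F`. Under the Laplace transform the
convolution becomes a factor φ(s) and the exponential average a difference of ρ(s/(1+a)) and ρ(μ),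
whence ρ(s) = J(s) ρ(s/(1+a)) + H(s) (`laplace_ruinFun_eq`). Iteration gives the series with
remainder ∏_{j<n} J(s/(1+a)^j) ρ(s/(1+a)^n).

The crux is that this remainder vanishes without any moment condition on `F`
(`tendsto_prodJ_mul_laplace`). Put σ_n = Re s/(1+a)^n, Q_n = ∏_{j<n} φ(σ_j) and v(t) = t ∫ e^{-tx}
R(x) dx. The rational factors of J give O((1+a)^{-n}), which cancels the growth of 1/σ_n in
|ρ(s/(1+a)^n)| ≤ v(σ_n)/σ_n, so the remainder is O(Q_n v(σ_n)) with both factors in [0,1]. Either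
Q_n → 0, or Q_n has a positive limit; in the latter case R vanishes at infinity (`tendsto_ruinFun`)
and v(σ_n) → 0 by an Abelian theorem (`tendsto_mul_integral_rexp_mul`).

The series converges absolutely because its terms are controlled by a geometric series and by the
telescoping differences Q_n - Q_{n+1} (`summable_prodJ_mul`). The singularities are removable
because ρ is continuous, and s = μ yields a linear equation for ρ(μ). -/

namespace DualRisk

/-! ### Deterministic path properties -/

section Path

variable {a x y : ℝ} {A C : ℕ → ℝ}

/-- The definition recurses at the last arrival; conditioning on the first arrival needs the
recursion from the front. -/
theorem preJump_succ' (a : ℝ) (A C : ℕ → ℝ) (x : ℝ) (n : ℕ) :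
    preJump a A C x (n + 1) =
      preJump a (fun i => A (i + 1)) (fun i => C (i + 1)) ((1 + a) * (x - A 0) + C 0) n := by
  induction n with
  | zero => simp [preJump]
  | succ n ih => rw [preJump, ih, preJump]

theorem preJump_mono (ha : 0 < a) (A C : ℕ → ℝ) (n : ℕ) :
    Monotone fun x => preJump a A C x n := by
  intro x y h
  induction n with
  | zero => simpa [preJump] using h
  | succ n ih =>
    simp only [preJump]
    have := mul_le_mul_of_nonneg_left ih (by linarith : (0 : ℝ) ≤ 1 + a)
    linarith

/-- Dropping the nonnegative gains leaves a linear recursion with factor `1 + a`. Hence ruin forces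
a discounted sum of interarrival times to exceed `x`. -/
theorem le_preJump (ha : 0 < a) (hC : ∀ i, 0 ≤ C i) (x : ℝ) (n : ℕ) :
    (1 + a) ^ n * (x - ∑ i ∈ Finset.range (n + 1), A i / (1 + a) ^ i) ≤ preJump a A C x n := by
  have hb : (0 : ℝ) < 1 + a := by linarith
  induction n with
  | zero => simp [preJump]
  | succ n ih =>
    rw [Finset.sum_range_succ, preJump]
    have h1 := mul_le_mul_of_nonneg_left ih hb.le
    have h2 : (1 + a) ^ (n + 1) * (A (n + 1) / (1 + a) ^ (n + 1)) = A (n + 1) := by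
      field_simp
    have h3 := hC n
    calc _ = (1 + a) * ((1 + a) ^ n * (x - ∑ i ∈ Finset.range (n + 1), A i / (1 + a) ^ i))
          - (1 + a) ^ (n + 1) * (A (n + 1) / (1 + a) ^ (n + 1)) := by ring
      _ ≤ _ := by rw [h2]; linarith

theorem surplus_eq_preJump (hA : ∀ i, 0 < A i) (a : ℝ) (C : ℕ → ℝ) (x : ℝ) {t : ℝ} {n : ℕ}
    (h1 : ∀ i < n, arrival A i ≤ t) (h2 : t < arrival A n) :
    surplus a A C x t = preJump a A C x n + (arrival A n - t) := by
  rw [preJump_eq, surplus, count_eq hA h1 h2]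
  ring

theorem arrival_succ (A : ℕ → ℝ) (n : ℕ) : arrival A (n + 1) = arrival A n + A (n + 1) := by
  rw [arrival, Finset.sum_range_succ, ← arrival]

/-- Ruin occurs exactly if the surplus just before some arrival is negative, when the surplus is
continued below `0`. -/
theorem ruinTime_lt_top_iff (ha : 0 < a) (hA : ∀ i, 0 < A i) (hC : ∀ i, 0 ≤ C i)
    (hT : ∀ t, ∃ n, t < arrival A n) (hx : 0 < x) :
    ruinTime a A C x < ⊤ ↔ ∃ n, preJump a A C x n < 0 := by
  classical
  have key : ruinTime a A C x < ⊤ ↔ ∃ t : ℝ≥0, surplus a A C x t = 0 := by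
    simp [ruinTime, iInf_lt_iff]
  rw [key]
  constructor
  · rintro ⟨t, ht⟩
    have h2 := Nat.find_spec (hT t)
    have h1 : ∀ i < Nat.find (hT t), arrival A i ≤ t := fun i hi =>
      not_lt.mp (Nat.find_min (hT t) hi)
    rw [surplus_eq_preJump hA a C x h1 h2] at ht
    exact ⟨_, by linarith⟩
  · intro h
    have h2 := Nat.find_spec h
    have h1 : ∀ i < Nat.find h, 0 ≤ preJump a A C x i := fun i hi =>
      not_lt.mp (Nat.find_min h hi)
    generalize Nat.find h = n at h1 h2
    -- At the first negative index `n`, following the slope `-1` back from the `n`-th arrival puts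
    -- the zero at `preJump n + arrival n`. It must be checked that this time is not before the
    -- preceding arrival.
    suffices H : 0 ≤ preJump a A C x n + arrival A n ∧
        ∀ i < n, arrival A i ≤ preJump a A C x n + arrival A n by
      refine ⟨NNReal.mk _ H.1, ?_⟩
      rw [NNReal.coe_mk, surplus_eq_preJump hA a C x H.2 (by linarith)]
      ring
    cases n with
    | zero => simp [preJump, arrival, hx.le]
    | succ m =>
      have h3 : arrival A m ≤ preJump a A C x (m + 1) + arrival A (m + 1) := by
        have := mul_nonneg (by linarith : (0 : ℝ) ≤ 1 + a) (h1 m (by omega))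
        rw [arrival_succ, preJump]
        linarith [hC m]
      refine ⟨le_trans (Finset.sum_nonneg fun i _ => (hA i).le) h3, fun i hi => ?_⟩
      exact ((strictMono_arrival hA).monotone (by omega)).trans h3

end Path

/-! ### Product law of the two sequences and the first-step equation -/

section Canonical

variable {a x y : ℝ} {F G : Measure ℝ}

/-- The joint law of independent sequences with marginals `F` and `G`. -/
noncomputable def seqLaw (F G : Measure ℝ) : Measure (ℕ ⊕ ℕ → ℝ) :=
  Measure.infinitePi (Sum.elim (fun _ => F) (fun _ => G))

/-- The event that some pre-jump value is negative. -/
def ruinSet (a x : ℝ) : Set (ℕ ⊕ ℕ → ℝ) :=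
  {z | ∃ n, preJump a (fun i => z (.inl i)) (fun i => z (.inr i)) x n < 0}

/-- The probability, under the product law, that some pre-jump value is negative. -/
noncomputable def ruinFun (a : ℝ) (F G : Measure ℝ) (x : ℝ) : ℝ :=
  (seqLaw F G).real (ruinSet a x)

/-- Removal of the first member of both sequences. -/
def shift (z : ℕ ⊕ ℕ → ℝ) : ℕ ⊕ ℕ → ℝ := fun i => z (i.map (· + 1) (· + 1))

instance sumElimProb [IsProbabilityMeasure F] [IsProbabilityMeasure G] (i : ℕ ⊕ ℕ) :
    IsProbabilityMeasure (Sum.elim (fun _ => F) (fun _ => G) i : Measure ℝ) := by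
  cases i <;> simpa

instance [IsProbabilityMeasure F] [IsProbabilityMeasure G] :
    IsProbabilityMeasure (seqLaw F G) := by
  unfold seqLaw; infer_instance

theorem measurable_preJump (a : ℝ) (n : ℕ) :
    Measurable fun p : ℝ × (ℕ ⊕ ℕ → ℝ) =>
      preJump a (fun i => p.2 (.inl i)) (fun i => p.2 (.inr i)) p.1 n := by
  induction n with
  | zero => simp only [preJump]; fun_prop
  | succ n ih => simp only [preJump]; fun_prop

/-- Measurability is needed jointly in level and path, because the level after the first arrival is
random. -/
theorem measurableSet_ruin (a : ℝ) :
    MeasurableSet {p : ℝ × (ℕ ⊕ ℕ → ℝ) | p.2 ∈ ruinSet a p.1} := by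
  have : {p : ℝ × (ℕ ⊕ ℕ → ℝ) | p.2 ∈ ruinSet a p.1} =
      ⋃ n, {p | preJump a (fun i => p.2 (.inl i)) (fun i => p.2 (.inr i)) p.1 n < 0} := by
    ext p
    simp [ruinSet]
  rw [this]
  exact MeasurableSet.iUnion fun n => measurableSet_lt (measurable_preJump a n) measurable_const

theorem measurableSet_ruinSet (a x : ℝ) : MeasurableSet (ruinSet a x) :=
  (measurable_const.prodMk measurable_id : Measurable fun z : ℕ ⊕ ℕ → ℝ => (x, z))
    (measurableSet_ruin a)

theorem mem_ruinSet_iff (a x : ℝ) (z : ℕ ⊕ ℕ → ℝ) :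
    z ∈ ruinSet a x ↔
      x < z (.inl 0) ∨ shift z ∈ ruinSet a ((1 + a) * (x - z (.inl 0)) + z (.inr 0)) := by
  constructor
  · rintro ⟨n, hn⟩
    cases n with
    | zero => exact .inl (by simpa [preJump] using hn)
    | succ n =>
      rw [preJump_succ'] at hn
      exact .inr ⟨n, hn⟩
  · rintro (h | ⟨n, hn⟩)
    · exact ⟨0, by simpa [preJump] using h⟩
    · refine ⟨n + 1, ?_⟩
      rw [preJump_succ']
      exact hn

theorem ruinSet_anti (ha : 0 < a) (h : x ≤ y) : ruinSet a y ⊆ ruinSet a x := by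
  rintro z ⟨n, hn⟩
  exact ⟨n, (preJump_mono ha _ _ n h).trans_lt hn⟩

/-- Disjoint subfamilies of an independent family are independent. -/
theorem _root_.ProbabilityTheory.iIndepFun.indepFun_restrict_of_disjoint
    {Ω ι : Type*} {mΩ : MeasurableSpace Ω}
    {P : Measure Ω} {β : ι → Type*} {mβ : ∀ i, MeasurableSpace (β i)} {X : ∀ i, Ω → β i}
    (hX : iIndepFun X P) (mX : ∀ i, Measurable (X i)) {S T : Set ι} (hST : Disjoint S T) :
    IndepFun (fun ω (i : S) => X i ω) (fun ω (i : T) => X i ω) P := by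
  have key : ∀ U : Set ι, MeasurableSpace.comap (fun ω (i : U) => X i ω) MeasurableSpace.pi
      = ⨆ i ∈ U, MeasurableSpace.comap (X i) (mβ i) := fun U => by
    rw [MeasurableSpace.pi, MeasurableSpace.comap_iSup, iSup_subtype]
    simp only [MeasurableSpace.comap_comp]
    rfl
  rw [IndepFun_iff_Indep, key, key]
  exact indep_iSup_of_disjoint (fun i => (mX i).comap_le) hX hST

theorem ruinFun_nonneg (x : ℝ) : 0 ≤ ruinFun a F G x := measureReal_nonneg

variable [IsProbabilityMeasure F] [IsProbabilityMeasure G]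

theorem map_shift : (seqLaw F G).map shift = seqLaw F G := by
  have hinj : Function.Injective (Sum.map (· + 1) (· + 1) : ℕ ⊕ ℕ → ℕ ⊕ ℕ) :=
    Function.Injective.sumMap (add_left_injective 1) (add_left_injective 1)
  have := Measure.map_infinitePi_infinitePi_of_inj
    (P := (Sum.elim (fun _ => F) (fun _ => G) : ℕ ⊕ ℕ → Measure ℝ)) hinj
  refine this.trans ?_
  unfold seqLaw
  congr 1
  ext1 i
  cases i <;> rfl

theorem measurable_shift : Measurable shift := by
  unfold shift; fun_prop

/-- The first pair and the shifted sequences read disjoint sets of coordinates, hence are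
independent, and the shift preserves the law. -/
theorem map_head_shift :
    (seqLaw F G).map (fun z => ((z (.inl 0), z (.inr 0)), shift z)) =
      (F.prod G).prod (seqLaw F G) := by
  have hind : iIndepFun (fun (i : ℕ ⊕ ℕ) (z : ℕ ⊕ ℕ → ℝ) => z i) (seqLaw F G) :=
    iIndepFun_infinitePi (P := (Sum.elim (fun _ => F) (fun _ => G) : ℕ ⊕ ℕ → Measure ℝ))
      (X := fun _ x => x) fun _ => measurable_id
  have hhead : (seqLaw F G).map (fun z => (z (.inl 0), z (.inr 0))) = F.prod G :=
    Measure.infinitePi_map_eval_prod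
      (P := (Sum.elim (fun _ => F) (fun _ => G) : ℕ ⊕ ℕ → Measure ℝ)) (by simp)
  have hdis : Disjoint ({.inl 0, .inr 0} : Set (ℕ ⊕ ℕ))
      (range (Sum.map (· + 1) (· + 1) : ℕ ⊕ ℕ → ℕ ⊕ ℕ)) := by
    rw [Set.disjoint_left]
    rintro _ (rfl | rfl) ⟨i | i, hi⟩ <;> simp at hi
  have h := hind.indepFun_restrict_of_disjoint (fun i => measurable_pi_apply i) hdis
  have h' : IndepFun (fun z : ℕ ⊕ ℕ → ℝ => (z (.inl 0), z (.inr 0))) shift (seqLaw F G) := by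
    have hφ : Measurable fun w : ({.inl 0, .inr 0} : Set (ℕ ⊕ ℕ)) → ℝ =>
        (w ⟨.inl 0, by simp⟩, w ⟨.inr 0, by simp⟩) := by fun_prop
    have hψ : Measurable fun (w : range (Sum.map (· + 1) (· + 1) : ℕ ⊕ ℕ → ℕ ⊕ ℕ) → ℝ)
        (i : ℕ ⊕ ℕ) => w ⟨_, mem_range_self i⟩ := by fun_prop
    exact h.comp hφ hψ
  rw [(indepFun_iff_map_prod_eq_prod_map_map (by fun_prop)
    measurable_shift.aemeasurable).mp h', hhead, map_shift]

theorem ruinFun_le_one (x : ℝ) : ruinFun a F G x ≤ 1 := measureReal_le_one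

theorem ruinFun_antitone (ha : 0 < a) : Antitone (ruinFun a F G) := fun _ _ h =>
  measureReal_mono (ruinSet_anti ha h)

theorem measurable_ruinFun (ha : 0 < a) : Measurable (ruinFun a F G) :=
  (ruinFun_antitone ha).measurable

/-- The probability of ruin from the level `y` just before the first jump, extended to the
negative half-line by `1`. -/
noncomputable def postRuin (a : ℝ) (F G : Measure ℝ) (y : ℝ) : ℝ :=
  if y < 0 then 1 else ∫ c, ruinFun a F G ((1 + a) * y + c) ∂G

/-- The path dichotomy `mem_ruinSet_iff` is integrated against the product law of head and tail by
Fubini. -/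
theorem ruinFun_eq (x : ℝ) :
    ruinFun a F G x = ∫ t, postRuin a F G (x - t) ∂F := by
  let B : Set ((ℝ × ℝ) × (ℕ ⊕ ℕ → ℝ)) :=
    {p | x < p.1.1 ∨ p.2 ∈ ruinSet a ((1 + a) * (x - p.1.1) + p.1.2)}
  have hB : MeasurableSet B := by
    refine MeasurableSet.union (measurableSet_lt measurable_const measurable_fst.fst) ?_
    have : Measurable fun p : (ℝ × ℝ) × (ℕ ⊕ ℕ → ℝ) =>
        ((1 + a) * (x - p.1.1) + p.1.2, p.2) := by fun_prop
    exact this (measurableSet_ruin a)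
  have hm : Measurable fun z : ℕ ⊕ ℕ → ℝ => ((z (.inl 0), z (.inr 0)), shift z) :=
    (by fun_prop : Measurable fun z : ℕ ⊕ ℕ → ℝ => (z (.inl 0), z (.inr 0))).prodMk
      measurable_shift
  have h1 : ruinFun a F G x = ((F.prod G).prod (seqLaw F G)).real B := by
    rw [← map_head_shift, map_measureReal_apply hm hB, ruinFun]
    congr 1
    ext z
    exact mem_ruinSet_iff a x z
  have hint : Integrable (B.indicator 1 : _ → ℝ) ((F.prod G).prod (seqLaw F G)) :=
    (integrable_const 1).indicator hB
  rw [h1, ← integral_indicator_one hB, integral_prod _ hint, integral_prod _ hint.integral_prod_left]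
  congr 1
  ext t
  unfold postRuin
  have h2 : ∀ c, ∫ z, B.indicator 1 ((t, c), z) ∂(seqLaw F G) =
      (seqLaw F G).real {z | ((t, c), z) ∈ B} := fun c =>
    integral_indicator_one (hB.preimage measurable_prodMk_left)
  simp only [h2]
  split_ifs with h
  · have h3 : ∀ c, {z | ((t, c), z) ∈ B} = univ := fun c =>
      eq_univ_of_forall fun z => Or.inl (by simpa using h)
    simp [h3]
  · congr 1
    ext c
    rw [ruinFun]
    congr 1
    ext z
    simp only [B, mem_ofPred_eq, or_iff_right_iff_imp]
    intro h'
    exact absurd (by linarith) h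

end Canonical

/-! ### Real transforms, unbounded arrival epochs and decay of the ruin probability -/

section RealTransform

variable {a x σ : ℝ} {F G : Measure ℝ}

/-- The Laplace–Stieltjes transform of a distribution at a real argument. -/
noncomputable def rlst (F : Measure ℝ) (σ : ℝ) : ℝ := ∫ t, Real.exp (-(σ * t)) ∂F

theorem lst_ofReal (F : Measure ℝ) (σ : ℝ) : lst F σ = rlst F σ := by
  rw [lst, rlst, ← integral_complex_ofReal]
  congr 1
  ext t
  push_cast
  ring_nf

theorem rlst_nonneg (F : Measure ℝ) (σ : ℝ) : 0 ≤ rlst F σ :=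
  integral_nonneg fun _ => (Real.exp_pos _).le

variable [IsProbabilityMeasure F]

theorem integrable_exp_neg (hF : ∀ᵐ t ∂F, 0 < t) (hσ : 0 ≤ σ) :
    Integrable (fun t => Real.exp (-(σ * t))) F := by
  refine Integrable.of_bound (by fun_prop) 1 ?_
  filter_upwards [hF] with t ht
  rw [Real.norm_eq_abs, Real.abs_exp, Real.exp_le_one_iff]
  have := mul_nonneg hσ ht.le
  linarith

theorem rlst_le_one (hF : ∀ᵐ t ∂F, 0 < t) (hσ : 0 ≤ σ) : rlst F σ ≤ 1 := by
  have : ∫ _, (1 : ℝ) ∂F = 1 := by simp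
  rw [← this]
  refine integral_mono_ae (integrable_exp_neg hF hσ) (integrable_const _) ?_
  filter_upwards [hF] with t ht
  rw [Real.exp_le_one_iff]
  have := mul_nonneg hσ ht.le
  linarith

theorem rlst_lt_one (hF : ∀ᵐ t ∂F, 0 < t) (hσ : 0 < σ) : rlst F σ < 1 := by
  have h1 : Integrable (fun t => 1 - Real.exp (-(σ * t))) F :=
    (integrable_const _).sub (integrable_exp_neg hF hσ.le)
  have hpos : ∀ᵐ t ∂F, 0 < 1 - Real.exp (-(σ * t)) := by
    filter_upwards [hF] with t ht
    have := mul_pos hσ ht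
    have : Real.exp (-(σ * t)) < 1 := by rw [Real.exp_lt_one_iff]; linarith
    linarith
  have h2 : 0 < ∫ t, (1 - Real.exp (-(σ * t))) ∂F := by
    rw [integral_pos_iff_support_of_nonneg_ae (hpos.mono fun t ht => ht.le) h1]
    have : F (Function.support fun t => 1 - Real.exp (-(σ * t))) = F univ :=
      measure_congr (eventuallyEq_univ.mpr (hpos.mono fun t ht => ht.ne'))
    rw [this]
    simp
  rw [integral_sub (integrable_const _) (integrable_exp_neg hF hσ.le)] at h2
  simp only [integral_const, probReal_univ, smul_eq_mul, one_mul] at h2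
  rw [rlst]
  linarith

variable [IsProbabilityMeasure G]

theorem measurePreserving_eval_seqLaw (i : ℕ ⊕ ℕ) :
    MeasurePreserving (fun z : ℕ ⊕ ℕ → ℝ => z i) (seqLaw F G)
      (Sum.elim (fun _ => F) (fun _ => G) i : Measure ℝ) :=
  measurePreserving_eval_infinitePi _ i

theorem ae_seqLaw (hF : ∀ᵐ t ∂F, 0 < t) (hG : ∀ᵐ t ∂G, 0 ≤ t) :
    ∀ᵐ z ∂(seqLaw F G), (∀ i : ℕ, 0 < z (.inl i)) ∧ ∀ i : ℕ, 0 ≤ z (.inr i) := by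
  rw [eventually_and, ae_all_iff, ae_all_iff]
  exact ⟨fun i => (measurePreserving_eval_seqLaw (.inl i)).quasiMeasurePreserving.ae hF,
    fun i => (measurePreserving_eval_seqLaw (.inr i)).quasiMeasurePreserving.ae hG⟩

theorem integral_exp_neg_sum (c : ℕ → ℝ) (n : ℕ) :
    ∫ z, Real.exp (-∑ i ∈ Finset.range n, c i * z (.inl i)) ∂(seqLaw F G) =
      ∏ i ∈ Finset.range n, rlst F (c i) := by
  have hind : iIndepFun (fun (i : ℕ ⊕ ℕ) (z : ℕ ⊕ ℕ → ℝ) => z i) (seqLaw F G) :=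
    iIndepFun_infinitePi (P := (Sum.elim (fun _ => F) (fun _ => G) : ℕ ⊕ ℕ → Measure ℝ))
      (X := fun _ x => x) fun _ => measurable_id
  have h2 : iIndepFun (fun (i : ℕ) (z : ℕ ⊕ ℕ → ℝ) => -(c i * z (.inl i))) (seqLaw F G) :=
    (hind.precomp Sum.inl_injective).comp (fun i x => -(c i * x)) fun i => by fun_prop
  have h3 := h2.mgf_sum (t := 1) (fun i => by fun_prop) (Finset.range n)
  simp only [mgf, one_mul, Finset.sum_apply, Finset.sum_neg_distrib] at h3
  rw [h3]
  refine Finset.prod_congr rfl fun i _ => ?_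
  have h4 : F = (seqLaw F G).map fun z => z (.inl i) :=
    (measurePreserving_eval_seqLaw (F := F) (G := G) (.inl i)).map_eq.symm
  rw [rlst]
  conv_rhs => rw [h4]
  rw [integral_map (measurable_pi_apply _).aemeasurable (by fun_prop)]

theorem integrable_exp_neg_sum (hF : ∀ᵐ t ∂F, 0 < t) (hG : ∀ᵐ t ∂G, 0 ≤ t) {c : ℕ → ℝ}
    (hc : ∀ i, 0 ≤ c i) (n : ℕ) :
    Integrable (fun z => Real.exp (-∑ i ∈ Finset.range n, c i * z (.inl i))) (seqLaw F G) := by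
  refine Integrable.of_bound (Measurable.aestronglyMeasurable (by fun_prop)) 1 ?_
  filter_upwards [ae_seqLaw hF hG] with z hz
  rw [Real.norm_eq_abs, Real.abs_exp, Real.exp_le_one_iff, neg_nonpos]
  exact Finset.sum_nonneg fun i _ => mul_nonneg (hc i) (hz.1 i).le

/-- Arrival epochs are almost surely unbounded. -/
theorem ae_exists_lt_arrival (hF : ∀ᵐ t ∂F, 0 < t) (hG : ∀ᵐ t ∂G, 0 ≤ t) :
    ∀ᵐ z ∂(seqLaw F G), ∀ t, ∃ n, t < arrival (fun i => z (.inl i)) n := by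
  have key : ∀ K : ℕ, ∀ᵐ z ∂(seqLaw F G), ∃ n, (K : ℝ) < arrival (fun i => z (.inl i)) n := by
    intro K
    rw [ae_iff]
    simp only [not_exists, not_lt]
    set S := {z : ℕ ⊕ ℕ → ℝ | ∀ n, arrival (fun i => z (.inl i)) n ≤ K}
    suffices (seqLaw F G).real S = 0 from (measureReal_eq_zero_iff).mp this
    -- Markov's inequality for e^{-T}, where `T` is the sum of `n + 1` interarrival times: on `S` it
    -- is at least e^{-K}, and by independence its mean is φ(1)^(n+1).
    have hb : ∀ n, Real.exp (-K) * (seqLaw F G).real S ≤ rlst F 1 ^ (n + 1) := fun n => by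
      have h1 := mul_meas_ge_le_integral_of_nonneg
        (ae_of_all _ fun z => (Real.exp_pos _).le)
        (integrable_exp_neg_sum hF hG (c := fun _ => 1) (fun _ => zero_le_one) (n + 1))
        (Real.exp (-K))
      rw [integral_exp_neg_sum, Finset.prod_const, Finset.card_range] at h1
      refine le_trans (mul_le_mul_of_nonneg_left (measureReal_mono ?_) (Real.exp_pos _).le) h1
      intro z hz
      have := hz n
      simp only [mem_ofPred_eq, Real.exp_le_exp, neg_le_neg_iff, one_mul]
      exact this
    have hlim : Tendsto (fun n : ℕ => rlst F 1 ^ (n + 1)) atTop (𝓝 0) :=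
      (tendsto_pow_atTop_nhds_zero_of_lt_one (rlst_nonneg F 1)
        (rlst_lt_one hF one_pos)).comp (tendsto_add_atTop_nat 1)
    have h0 : Real.exp (-K) * (seqLaw F G).real S ≤ 0 := ge_of_tendsto' hlim hb
    have h1 : (0 : ℝ) ≤ (seqLaw F G).real S := measureReal_nonneg
    have h2 := Real.exp_pos (-(K : ℝ))
    nlinarith
  filter_upwards [ae_all_iff.mpr key] with z hz t
  obtain ⟨K, hK⟩ := exists_nat_gt t
  obtain ⟨n, hn⟩ := hz K
  exact ⟨n, hK.trans hn⟩

/-- An upper bound for the ruin probability from the discounted sum of interarrival times. -/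
theorem ruinFun_mul_le (ha : 0 < a) (hF : ∀ᵐ t ∂F, 0 < t) (hG : ∀ᵐ t ∂G, 0 ≤ t)
    (hσ : 0 < σ) {δ : ℝ} (hδ : ∀ n, δ ≤ ∏ i ∈ Finset.range n, rlst F (σ / (1 + a) ^ i)) :
    (1 - Real.exp (-(σ * x))) * ruinFun a F G x ≤ 1 - δ := by
  rcases le_or_gt (1 - Real.exp (-(σ * x))) 0 with hneg | hxpos
  · have h0 : δ ≤ 1 := by simpa using hδ 0
    have := mul_nonneg_of_nonpos_of_nonpos (a := 1 - Real.exp (-(σ * x)))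
      (b := -ruinFun a F G x) hneg (by linarith [ruinFun_nonneg (a := a) (F := F) (G := G) x])
    linarith
  have hb : (0 : ℝ) < 1 + a := by linarith
  -- These events increase with `n` only almost surely, where the interarrival times are positive;
  -- `accumulate` makes them increasing everywhere, for continuity from below.
  let D : ℕ → Set (ℕ ⊕ ℕ → ℝ) := fun n =>
    {z | x < ∑ i ∈ Finset.range (n + 1), z (.inl i) / (1 + a) ^ i}
  have hD : ∀ n, (1 - Real.exp (-(σ * x))) * (seqLaw F G).real (accumulate D n) ≤ 1 - δ := by
    intro n
    have hc : ∀ i : ℕ, 0 ≤ σ / (1 + a) ^ i := fun i => by positivity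
    have hint := integrable_exp_neg_sum (c := fun i : ℕ => σ / (1 + a) ^ i) hF hG hc (n + 1)
    have h1 := mul_meas_ge_le_integral_of_nonneg (μ := seqLaw F G)
      (f := fun z => 1 - Real.exp (-∑ i ∈ Finset.range (n + 1), σ / (1 + a) ^ i * z (.inl i)))
      (by
        filter_upwards [ae_seqLaw hF hG] with z hz
        simp only [Pi.zero_apply, sub_nonneg, Real.exp_le_one_iff, neg_nonpos]
        exact Finset.sum_nonneg fun i _ => mul_nonneg (hc i) (hz.1 i).le)
      ((integrable_const _).sub hint) (1 - Real.exp (-(σ * x)))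
    rw [integral_sub (integrable_const _) hint, integral_exp_neg_sum] at h1
    simp only [integral_const, probReal_univ, smul_eq_mul, one_mul] at h1
    have h2 := hδ (n + 1)
    refine le_trans ?_ (h1.trans (by linarith))
    refine mul_le_mul_of_nonneg_left ?_ hxpos.le
    refine ENNReal.toReal_mono (measure_ne_top _ _) (measure_mono_ae ?_)
    filter_upwards [ae_seqLaw hF hG] with z hz hzD
    obtain ⟨m, hm, hmD⟩ := mem_accumulate.mp hzD
    change 1 - Real.exp (-(σ * x)) ≤ 1 - Real.exp _
    rw [sub_le_sub_iff_left, Real.exp_le_exp, neg_le_neg_iff]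
    have h3 : ∑ i ∈ Finset.range (m + 1), z (.inl i) / (1 + a) ^ i ≤
        ∑ i ∈ Finset.range (n + 1), z (.inl i) / (1 + a) ^ i :=
      Finset.sum_le_sum_of_subset_of_nonneg (by gcongr)
        fun i _ _ => div_nonneg (hz.1 i).le (by positivity)
    have h4 : x < ∑ i ∈ Finset.range (m + 1), z (.inl i) / (1 + a) ^ i := hmD
    calc σ * x ≤ σ * ∑ i ∈ Finset.range (n + 1), z (.inl i) / (1 + a) ^ i := by
          gcongr; linarith
      _ = _ := by
          rw [Finset.mul_sum]
          refine Finset.sum_congr rfl fun i _ => by ring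
  have hlim : Tendsto (fun n => (1 - Real.exp (-(σ * x))) * (seqLaw F G).real (accumulate D n))
      atTop (𝓝 ((1 - Real.exp (-(σ * x))) * (seqLaw F G).real (⋃ n, D n))) :=
    ((ENNReal.tendsto_toReal (measure_ne_top _ _)).comp
      tendsto_measure_iUnion_accumulate).const_mul _
  refine le_trans (mul_le_mul_of_nonneg_left ?_ hxpos.le) (le_of_tendsto' hlim hD)
  refine ENNReal.toReal_mono (measure_ne_top _ _) (measure_mono_ae ?_)
  filter_upwards [ae_seqLaw hF hG] with z hz hzR
  obtain ⟨n, hn⟩ := hzR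
  refine mem_iUnion.mpr ⟨n, ?_⟩
  have h1 := (le_preJump (A := fun i => z (.inl i)) ha hz.2 x n).trans_lt hn
  have h2 : 0 < (1 + a) ^ n := by positivity
  change x < _
  by_contra! h
  exact absurd h1 (not_lt.mpr (mul_nonneg h2.le (by linarith)))

/-- If the infinite product of the transforms is positive, the ruin probability vanishes at
infinity. -/
theorem tendsto_ruinFun (ha : 0 < a) (hF : ∀ᵐ t ∂F, 0 < t) (hG : ∀ᵐ t ∂G, 0 ≤ t)
    (hσ : 0 < σ) {p : ℝ} (hp : 0 < p)
    (hlim : Tendsto (fun n => ∏ i ∈ Finset.range n, rlst F (σ / (1 + a) ^ i)) atTop (𝓝 p)) :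
    Tendsto (ruinFun a F G) atTop (𝓝 0) := by
  have hb : (0 : ℝ) < 1 + a := by linarith
  set q : ℕ → ℝ := fun n => ∏ i ∈ Finset.range n, rlst F (σ / (1 + a) ^ i) with hq
  have hanti : Antitone q := antitone_nat_of_succ_le fun n => by
    simp only [hq, Finset.prod_range_succ]
    exact mul_le_of_le_one_right (Finset.prod_nonneg fun i _ => rlst_nonneg F _)
      (rlst_le_one hF (by positivity))
  have hple : ∀ n, p ≤ q n := fun n => hanti.le_of_tendsto hlim n
  -- `p / q m` is the infinite product started at index `m`, that is, with `σ / (1 + a) ^ m` in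
  -- place of `σ`. Applying `ruinFun_mul_le` at this smaller argument makes the right-hand side `1 -
  -- p / q m` as small as desired.
  have hratio : Tendsto (fun m => p / q m) atTop (𝓝 1) := by
    have := (tendsto_const_nhds (x := p)).div hlim hp.ne'
    rwa [div_self hp.ne'] at this
  rw [Metric.tendsto_atTop]
  intro η hη
  obtain ⟨m, hm⟩ := (hratio.eventually (lt_mem_nhds (show 1 - η / 2 < 1 by linarith))).exists
  set ε := σ / (1 + a) ^ m with hε
  have hε0 : 0 < ε := by positivity
  have hqm : 0 < q m := hp.trans_le (hple m)
  have hδ : ∀ n, p / q m ≤ ∏ i ∈ Finset.range n, rlst F (ε / (1 + a) ^ i) := fun n => by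
    rw [div_le_iff₀ hqm]
    refine (hple (m + n)).trans (le_of_eq ?_)
    rw [hq, mul_comm]
    simp only [Finset.prod_range_add]
    congr 1
    refine Finset.prod_congr rfl fun i _ => ?_
    rw [hε, div_div, pow_add]
  -- Beyond this level 1 - e^{-εx} ≥ 1/2, so the bound `η / 2` on the product gives `η` for the ruin
  -- probability.
  refine ⟨Real.log 2 / ε, fun x hx => ?_⟩
  have h1 := ruinFun_mul_le (x := x) ha hF hG hε0 hδ
  have h2 : Real.exp (-(ε * x)) ≤ 1 / 2 := by
    rw [ge_iff_le, div_le_iff₀ hε0] at hx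
    calc Real.exp (-(ε * x)) ≤ Real.exp (-Real.log 2) := by
          rw [Real.exp_le_exp]; linarith
      _ = 1 / 2 := by rw [Real.exp_neg, Real.exp_log (by norm_num)]; norm_num
  have h3 := ruinFun_nonneg (a := a) (F := F) (G := G) x
  rw [Real.dist_eq, sub_zero, abs_of_nonneg h3]
  nlinarith

end RealTransform

/-- The ruin probability depends on the joint law only. -/
theorem ruinProb_eq {Ω : Type*} [MeasurableSpace Ω] {P : Measure Ω} {a : ℝ} (ha : 0 < a)
    {F G : Measure ℝ} [IsProbabilityMeasure F] [IsProbabilityMeasure G]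
    (hF : ∀ᵐ t ∂F, 0 < t) (hG : ∀ᵐ t ∂G, 0 ≤ t) {A C : ℕ → Ω → ℝ}
    (hA : ∀ i, HasLaw (A i) F P) (hC : ∀ i, HasLaw (C i) G P)
    (hAC : iIndepFun (Sum.elim A C) P) {x : ℝ} (hx : 0 < x) :
    ruinProb P a A C x = ruinFun a F G x := by
  have hlaw : ∀ i, HasLaw (Sum.elim A C i)
      (Sum.elim (fun _ => F) (fun _ => G) i : Measure ℝ) P := by
    rintro (i | i)
    exacts [hA i, hC i]
  have hm : AEMeasurable (fun ω i => Sum.elim A C i ω) P :=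
    aemeasurable_pi_lambda _ fun i => (hlaw i).aemeasurable
  have hmap : P.map (fun ω i => Sum.elim A C i ω) = seqLaw F G :=
    (hAC.hasLaw_infinitePi hlaw hm).map_eq
  rw [ruinFun, ← hmap, map_measureReal_apply_of_aemeasurable hm (measurableSet_ruinSet a x),
    ruinProb]
  refine measureReal_congr ?_
  have h1 := ae_seqLaw hF hG
  have h2 := ae_exists_lt_arrival hF hG
  rw [← hmap] at h1 h2
  filter_upwards [ae_of_ae_map hm h1, ae_of_ae_map hm h2] with ω h3 h4
  exact propext (ruinTime_lt_top_iff ha h3.1 h3.2 h4 hx)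

/-! ### Functional equation of the Laplace transform -/

section Equation

theorem integral_Ioi_comp_sub {E : Type*} [NormedAddCommGroup E] [NormedSpace ℝ E]
    (f : ℝ → E) (c : ℝ) : ∫ x in Ioi c, f (x - c) = ∫ y in Ioi 0, f y := by
  have := (measurePreserving_sub_right volume c).setIntegral_preimage_emb
    (measurableEmbedding_subRight c) f (Ioi 0)
  rwa [preimage_sub_const_Ioi, zero_add] at this

theorem integral_expMeasure {μ : ℝ} (hμ : 0 < μ) (f : ℝ → ℝ) :
    ∫ c, f c ∂(expMeasure μ) = ∫ c in Ioi 0, μ * Real.exp (-(μ * c)) * f c := by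
  change ∫ c, f c ∂(volume.withDensity (exponentialPDF μ)) = _
  have hm : Measurable (exponentialPDF μ) := (measurable_exponentialPDFReal μ).ennreal_ofReal
  rw [integral_withDensity_eq_integral_toReal_smul hm
    (ae_of_all _ fun _ => ENNReal.ofReal_lt_top), ← integral_Ici_eq_integral_Ioi,
    ← integral_indicator measurableSet_Ici]
  congr 1
  ext c
  by_cases hc : 0 ≤ c
  · rw [indicator_of_mem (show c ∈ Ici 0 from hc), exponentialPDF_of_nonneg hc,
      ENNReal.toReal_ofReal (mul_nonneg hμ.le (Real.exp_pos _).le), smul_eq_mul]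
  · rw [indicator_of_notMem (show c ∉ Ici 0 from hc), exponentialPDF_of_neg (not_le.mp hc)]
    simp

theorem ae_expMeasure_nonneg (μ : ℝ) : ∀ᵐ t ∂(expMeasure μ), 0 ≤ t := by
  rw [ae_iff]
  simp only [not_le]
  change (volume.withDensity (exponentialPDF μ)) (Iio 0) = 0
  rw [withDensity_apply _ measurableSet_Iio]
  exact lintegral_exponentialPDF_of_nonpos le_rfl

theorem integrableOn_exp_mul_bounded {R : ℝ → ℝ} (hR : Measurable R) {K : ℝ}
    (hK : ∀ x, |R x| ≤ K) {s : ℂ} (hs : 0 < s.re) :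
    IntegrableOn (fun x : ℝ => Complex.exp (-s * x) * (R x : ℂ)) (Ioi 0) := by
  refine Integrable.mul_bdd (c := K) (integrableOn_exp_mul_complex_Ioi (by simpa using hs) 0)
    (by fun_prop) (ae_of_all _ fun x => ?_)
  simpa using hK x

theorem integral_exp_neg_Ioi_complex {s : ℂ} (hs : 0 < s.re) :
    ∫ x in Ioi (0 : ℝ), Complex.exp (-s * x) = 1 / s := by
  rw [integral_exp_mul_complex_Ioi (by simpa using hs)]
  simp [neg_div_neg_eq]

variable {F : Measure ℝ} [IsProbabilityMeasure F]

theorem integrable_cexp (hF : ∀ᵐ t ∂F, 0 < t) {s : ℂ} (hs : 0 < s.re) :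
    Integrable (fun t : ℝ => Complex.exp (-s * t)) F := by
  refine Integrable.of_bound (by fun_prop) 1 ?_
  filter_upwards [hF] with t ht
  rw [Complex.norm_exp, Real.exp_le_one_iff]
  simp
  positivity

/-- The Laplace transform of a convolution with a probability measure, for a function that equals
`1` on the negative half-line. -/
theorem laplace_convolution (hF : ∀ᵐ t ∂F, 0 < t) {g : ℝ → ℝ} (hg : Measurable g)
    (hg1 : ∀ y < 0, g y = 1) {K : ℝ} (hK : ∀ y, |g y| ≤ K) {s : ℂ} (hs : 0 < s.re) :
    laplace (fun x => ∫ t, g (x - t) ∂F) s = (1 - lst F s) / s + lst F s * laplace g s := by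
  have hs0 : s ≠ 0 := by rintro rfl; simp at hs
  have hint : Integrable (Function.uncurry fun (x t : ℝ) =>
      Complex.exp (-s * x) * (g (x - t) : ℂ)) ((volume.restrict (Ioi (0 : ℝ))).prod F) := by
    refine Integrable.mul_bdd (c := K) (f := fun p : ℝ × ℝ => Complex.exp (-s * p.1))
      (g := fun p : ℝ × ℝ => (g (p.1 - p.2) : ℂ))
      ((integrableOn_exp_mul_complex_Ioi (by simpa using hs) 0).comp_fst F)
      (Measurable.aestronglyMeasurable (by fun_prop)) (ae_of_all _ fun x => ?_)
    simpa using hK _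
  have h1 : laplace (fun x => ∫ t, g (x - t) ∂F) s =
      ∫ x in Ioi (0 : ℝ), ∫ t, Complex.exp (-s * x) * (g (x - t) : ℂ) ∂F := by
    unfold laplace
    congr 1
    ext x
    rw [integral_const_mul, integral_complex_ofReal]
  have hinner : ∀ t : ℝ, 0 < t → ∫ x in Ioi (0 : ℝ), Complex.exp (-s * x) * (g (x - t) : ℂ) =
      1 / s + Complex.exp (-s * t) * (laplace g s - 1 / s) := by
    intro t ht
    -- Splitting off the constant `1` leaves g(x - t) - 1, which vanishes for x < t, so a
    -- translation by `t` reduces it to integrals over the half-line.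
    have e1 : ∫ x in Ioi (0 : ℝ), Complex.exp (-s * x) * (g (x - t) : ℂ) =
        1 / s + ∫ x in Ioi (0 : ℝ), Complex.exp (-s * x) * ((g (x - t) : ℂ) - 1) := by
      rw [← integral_exp_neg_Ioi_complex hs, ← integral_add]
      · congr 1; ext x; ring
      · exact integrableOn_exp_mul_complex_Ioi (by simpa using hs) 0
      · have := (integrableOn_exp_mul_bounded (R := fun x => g (x - t)) (by fun_prop)
          (fun x => hK _) hs).sub (integrableOn_exp_mul_complex_Ioi (a := -s) (by simpa using hs) 0)
        refine this.congr (ae_of_all _ fun x => ?_)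
        simp only [Pi.sub_apply]
        ring
    have e2 : ∫ x in Ioi (0 : ℝ), Complex.exp (-s * x) * ((g (x - t) : ℂ) - 1) =
        ∫ x in Ici t, Complex.exp (-s * x) * ((g (x - t) : ℂ) - 1) := by
      refine setIntegral_eq_of_subset_of_forall_sdiff_eq_zero measurableSet_Ioi
        (fun x hx => ht.trans_le hx) fun x hx => ?_
      have : x < t := not_le.mp hx.2
      rw [hg1 _ (by linarith)]
      simp
    obtain ⟨f, hf⟩ : ∃ f : ℝ → ℂ, f = fun y : ℝ => Complex.exp (-s * t) *
        (Complex.exp (-s * y) * (g y : ℂ) - Complex.exp (-s * y)) := ⟨_, rfl⟩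
    have e3 : ∀ x : ℝ, Complex.exp (-s * x) * ((g (x - t) : ℂ) - 1) = f (x - t) := fun x => by
      have : Complex.exp (-s * x) = Complex.exp (-s * t) * Complex.exp (-s * ((x - t : ℝ) : ℂ)) := by
        rw [← Complex.exp_add]
        congr 1
        push_cast
        ring
      rw [hf]
      simp only [this]
      ring
    rw [e1, e2, integral_Ici_eq_integral_Ioi]
    simp only [e3]
    rw [integral_Ioi_comp_sub, hf, integral_const_mul, integral_sub
      (integrableOn_exp_mul_bounded hg hK hs)
      (integrableOn_exp_mul_complex_Ioi (by simpa using hs) 0), integral_exp_neg_Ioi_complex hs]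
    rfl
  rw [h1, integral_integral_swap hint, integral_congr_ae (hF.mono fun t ht => hinner t ht),
    integral_add (integrable_const _) ((integrable_cexp hF hs).mul_const _), integral_mul_const]
  simp only [integral_const, probReal_univ, one_smul]
  rw [lst]
  field_simp
  ring

/-- The Laplace transform of `y ↦ 𝔼 R (b y + C)` with `C` exponentially distributed. -/
theorem laplace_integral_expMeasure {μ b : ℝ} (hμ : 0 < μ) (hb : 0 < b) {R : ℝ → ℝ}
    (hR : Measurable R) (hR0 : ∀ x, 0 ≤ R x) (hR1 : ∀ x, R x ≤ 1) {s : ℂ} (hs : 0 < s.re)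
    (hsμ : s ≠ μ * b) :
    laplace (fun y => ∫ c, R (b * y + c) ∂(expMeasure μ)) s =
      μ / (μ * b - s) * (laplace R (s / b) - laplace R μ) := by
  have hR' : ∀ x, |R x| ≤ 1 := fun x => abs_le.mpr ⟨by linarith [hR0 x], hR1 x⟩
  -- The kernel after the substitution z = b y + c. With the order of integration exchanged, `y`
  -- runs over (0, z/b) and its integrand is a pure exponential.
  let k : ℝ → ℝ → ℂ := fun y z => (Ioi (b * y)).indicator
    (fun z : ℝ => Complex.exp (-s * y) * ((μ * Real.exp (-(μ * (z - b * y))) * R z : ℝ) : ℂ)) z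
  have h1 : ∀ y : ℝ, 0 < y →
      Complex.exp (-s * y) * ((∫ c, R (b * y + c) ∂(expMeasure μ) : ℝ) : ℂ) =
      ∫ z in Ioi 0, k y z := by
    intro y hy
    have hby : 0 < b * y := mul_pos hb hy
    rw [integral_expMeasure hμ, ← integral_complex_ofReal, ← integral_const_mul,
      ← integral_Ioi_comp_sub _ (b * y), setIntegral_indicator measurableSet_Ioi, inter_comm,
      inter_eq_left.mpr (Ioi_subset_Ioi hby.le)]
    congr 1
    ext z
    rw [add_sub_cancel]
  have hint : Integrable (Function.uncurry k)
      ((volume.restrict (Ioi (0 : ℝ))).prod (volume.restrict (Ioi (0 : ℝ)))) := by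
    -- A majorant with `R` replaced by `1`; its integral over `z` is e^{-y Re s}, since the
    -- exponential density has mass one.
    obtain ⟨k', hk'⟩ : ∃ k' : ℝ × ℝ → ℝ, k' = {p : ℝ × ℝ | b * p.1 < p.2}.indicator fun p =>
        Real.exp (-s.re * p.1) * (μ * Real.exp (-(μ * (p.2 - b * p.1)))) := ⟨_, rfl⟩
    have hset : MeasurableSet {p : ℝ × ℝ | b * p.1 < p.2} :=
      measurableSet_lt (by fun_prop) (by fun_prop)
    have hk'm : Measurable k' := by
      rw [hk']
      exact Measurable.indicator (by fun_prop) hset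
    have hkm : Measurable (Function.uncurry k) := by
      have : Function.uncurry k = {p : ℝ × ℝ | b * p.1 < p.2}.indicator fun p =>
          Complex.exp (-s * p.1) * ((μ * Real.exp (-(μ * (p.2 - b * p.1))) * R p.2 : ℝ) : ℂ) := by
        ext ⟨y, z⟩
        rfl
      rw [this]
      exact Measurable.indicator (by fun_prop) hset
    have hk'0 : ∀ p, 0 ≤ k' p := fun p => by
      rw [hk']
      exact indicator_nonneg (fun p _ => by positivity) p
    refine Integrable.mono' (g := k') ?_ hkm.aestronglyMeasurable (ae_of_all _ ?_)
    · have hslice : ∀ y : ℝ, (fun z => k' (y, z)) = (Ioi (b * y)).indicator fun z =>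
          Real.exp (-s.re * y) * (μ * Real.exp (-(μ * (z - b * y)))) := fun y => by
        rw [hk']
        rfl
      rw [integrable_prod_iff hk'm.aestronglyMeasurable]
      constructor
      · refine ae_of_all _ fun y => ?_
        rw [hslice]
        refine Integrable.indicator ?_ measurableSet_Ioi
        refine ((integrableOn_exp_mul_Ioi (neg_lt_zero.mpr hμ) 0).const_mul
          (Real.exp (-s.re * y) * (μ * Real.exp (μ * (b * y))))).congr (ae_of_all _ fun z => ?_)
        simp only
        rw [mul_assoc, mul_assoc, ← Real.exp_add]
        ring_nf
      · refine (integrableOn_exp_mul_Ioi (neg_lt_zero.mpr hs) 0).congr ?_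
        filter_upwards [ae_restrict_mem measurableSet_Ioi] with y hy
        have hby : 0 < b * y := mul_pos hb hy
        simp only [Real.norm_of_nonneg (hk'0 _), hslice]
        rw [setIntegral_indicator measurableSet_Ioi, inter_comm,
          inter_eq_left.mpr (Ioi_subset_Ioi hby.le),
          integral_Ioi_comp_sub (fun c => Real.exp (-s.re * y) * (μ * Real.exp (-(μ * c)))),
          integral_const_mul, integral_const_mul]
        simp only [← neg_mul]
        rw [integral_exp_mul_Ioi (neg_lt_zero.mpr hμ)]
        simp [hμ.ne']
    · rintro ⟨y, z⟩
      rw [hk']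
      simp only [Function.uncurry, k, indicator, mem_Ioi, mem_ofPred_eq]
      split_ifs
      swap
      · simp
      rw [norm_mul, Complex.norm_exp, Complex.norm_real, Real.norm_of_nonneg
        (mul_nonneg (by positivity) (hR0 z))]
      simp only [Complex.mul_re, Complex.neg_re, Complex.ofReal_re, Complex.neg_im,
        Complex.ofReal_im, mul_zero, sub_zero]
      exact mul_le_mul_of_nonneg_left (mul_le_of_le_one_right (by positivity) (hR1 z))
        (Real.exp_pos _).le
  -- The endpoint y = z/b produces the exponent -(s/b) z and y = 0 produces -μ z: these become the
  -- transforms at s/b and at μ.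
  have h2 : ∀ z : ℝ, 0 < z → ∫ y in Ioi (0 : ℝ), k y z =
      μ / (μ * b - s) * (Complex.exp (-(s / b) * z) * R z - Complex.exp (-(μ : ℂ) * z) * R z) := by
    intro z hz
    have hc : (μ : ℂ) * b - s ≠ 0 := sub_ne_zero.mpr hsμ.symm
    have hb' : (b : ℂ) ≠ 0 := by exact_mod_cast hb.ne'
    have e1 : (fun y => k y z) = (Iio (z / b)).indicator fun y : ℝ =>
        (μ * Complex.exp (-(μ : ℂ) * z) * R z) * Complex.exp ((μ * b - s) * y) := by
      ext y
      simp only [k, indicator, mem_Ioi, mem_Iio, lt_div_iff₀ hb, mul_comm y b]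
      split_ifs
      · push_cast
        have : Complex.exp (-s * y) * Complex.exp (-(μ * (z - b * y))) =
            Complex.exp (-(μ : ℂ) * z) * Complex.exp ((μ * b - s) * y) := by
          rw [← Complex.exp_add, ← Complex.exp_add]
          ring_nf
        linear_combination (μ * R z : ℂ) * this
      · rfl
    have e2 : Complex.exp (-(s / b) * z) = Complex.exp (-(μ : ℂ) * z) *
        Complex.exp ((μ * b - s) * ((z / b : ℝ) : ℂ)) := by
      rw [← Complex.exp_add]
      congr 1
      push_cast
      field_simp
      ring
    rw [e1, setIntegral_indicator measurableSet_Iio, Ioi_inter_Iio, ← integral_Ioc_eq_integral_Ioo,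
      ← intervalIntegral.integral_of_le (by positivity), intervalIntegral.integral_const_mul,
      integral_exp_mul_complex hc, e2]
    simp only [Complex.ofReal_zero, mul_zero, Complex.exp_zero]
    field_simp
  unfold laplace
  rw [setIntegral_congr_fun measurableSet_Ioi fun y hy => h1 y hy, integral_integral_swap hint,
    setIntegral_congr_fun measurableSet_Ioi fun y hy => h2 y hy, integral_const_mul, integral_sub]
  · refine integrableOn_exp_mul_bounded hR hR' ?_
    rw [Complex.div_ofReal_re]
    positivity
  · exact integrableOn_exp_mul_bounded hR hR' (by simpa using hμ)

theorem measurable_postRuin {a : ℝ} (ha : 0 < a) {G : Measure ℝ} [IsProbabilityMeasure G] :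
    Measurable (postRuin a F G) := by
  unfold postRuin
  refine Measurable.ite measurableSet_Iio measurable_const ?_
  have := measurable_ruinFun (F := F) (G := G) ha
  exact (StronglyMeasurable.integral_prod_right (f := fun y c => ruinFun a F G ((1 + a) * y + c))
    (Measurable.stronglyMeasurable (by unfold Function.uncurry; fun_prop))).measurable

theorem abs_postRuin_le_one {a : ℝ} {G : Measure ℝ} [IsProbabilityMeasure G] (y : ℝ) :
    |postRuin a F G y| ≤ 1 := by
  unfold postRuin
  split_ifs
  · simp
  · have := norm_integral_le_of_norm_le_const (μ := G) (C := 1)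
      (f := fun c => ruinFun a F G ((1 + a) * y + c)) (ae_of_all _ fun c => by
        rw [Real.norm_eq_abs, abs_of_nonneg (ruinFun_nonneg _)]
        exact ruinFun_le_one _)
    simpa using this

/-- The functional equation of the Laplace transform of the ruin probability. -/
theorem laplace_ruinFun_eq {a μ : ℝ} (ha : 0 < a) (hμ : 0 < μ) (hF : ∀ᵐ t ∂F, 0 < t)
    {s : ℂ} (hs : 0 < s.re) (hsμ : s ≠ μ * (1 + a)) :
    laplace (ruinFun a F (expMeasure μ)) s =
      J a μ F s * laplace (ruinFun a F (expMeasure μ)) (s / (1 + a)) +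
        H a μ F (laplace (ruinFun a F (expMeasure μ)) μ) s := by
  have := isProbabilityMeasure_expMeasure hμ
  set R := ruinFun a F (expMeasure μ) with hRdef
  have e1 : laplace R s = laplace (fun x => ∫ t, postRuin a F (expMeasure μ) (x - t) ∂F) s := by
    congr 1
    ext x
    exact ruinFun_eq x
  have e2 : laplace (postRuin a F (expMeasure μ)) s =
      laplace (fun y => ∫ c, R ((1 + a) * y + c) ∂(expMeasure μ)) s := by
    refine setIntegral_congr_fun measurableSet_Ioi fun y hy => ?_
    simp only [postRuin]
    rw [if_neg (not_lt.mpr (le_of_lt hy))]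
  have hsμ' : s ≠ μ * ((1 + a : ℝ) : ℂ) := by push_cast; exact hsμ
  rw [e1, laplace_convolution hF (measurable_postRuin ha)
    (fun y hy => by rw [postRuin, if_pos hy]) abs_postRuin_le_one hs, e2,
    laplace_integral_expMeasure hμ (by linarith) (measurable_ruinFun ha) ruinFun_nonneg
      ruinFun_le_one hs hsμ', J, H]
  push_cast
  ring

end Equation

/-! ### Absolute convergence of the series -/

section Series

variable {a μ σ : ℝ} {F : Measure ℝ} {s : ℂ}

theorem re_div_pow (a : ℝ) (s : ℂ) (n : ℕ) :
    (s / (1 + (a : ℂ)) ^ n).re = s.re / (1 + a) ^ n := by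
  rw [← Complex.div_ofReal_re]
  push_cast
  rfl

theorem re_div_pow_pos (ha : 0 < a) (hs : 0 < s.re) (n : ℕ) :
    0 < (s / (1 + (a : ℂ)) ^ n).re := by
  rw [re_div_pow]
  positivity

theorem norm_one_add_ofReal (ha : 0 < a) : ‖1 + (a : ℂ)‖ = 1 + a := by
  rw [← Complex.ofReal_one, ← Complex.ofReal_add, Complex.norm_real,
    Real.norm_of_nonneg (by linarith)]

theorem one_add_ofReal_ne_zero (ha : 0 < a) : 1 + (a : ℂ) ≠ 0 := by
  rw [← norm_ne_zero_iff, norm_one_add_ofReal ha]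
  linarith

/-- The product `∏_{j < n} φ(σ / (1 + a)^j)`. -/
noncomputable def prodLst (a : ℝ) (F : Measure ℝ) (σ : ℝ) (n : ℕ) : ℝ :=
  ∏ j ∈ Finset.range n, rlst F (σ / (1 + a) ^ j)

theorem norm_lst_le (F : Measure ℝ) (s : ℂ) : ‖lst F s‖ ≤ rlst F s.re := by
  refine (norm_integral_le_integral_norm _).trans_eq ?_
  simp [rlst, Complex.norm_exp]

/-- Follows from 1 - e^{-st} = s ∫_0^t e^{-su} du. The constant |s| / Re s is unchanged when `s` is
divided by a power of `1 + a`, so one bound serves all terms of the series. -/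
theorem norm_one_sub_cexp_le (hs : 0 < s.re) {t : ℝ} (ht : 0 ≤ t) :
    ‖1 - Complex.exp (-s * t)‖ ≤ ‖s‖ / s.re * (1 - Real.exp (-(s.re * t))) := by
  have hs0 : s ≠ 0 := by rintro rfl; simp at hs
  have h1 : 1 - Complex.exp (-s * t) = s * ∫ u in (0 : ℝ)..t, Complex.exp (-s * u) := by
    rw [integral_exp_mul_complex (neg_ne_zero.mpr hs0)]
    simp only [Complex.ofReal_zero, mul_zero, Complex.exp_zero]
    field_simp
    ring
  have h2 : ∫ u in (0 : ℝ)..t, Real.exp (-s.re * u) = (1 - Real.exp (-(s.re * t))) / s.re := by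
    rw [intervalIntegral.integral_comp_mul_left (fun x => Real.exp x) (neg_ne_zero.mpr hs.ne'),
      integral_exp, smul_eq_mul, mul_zero, Real.exp_zero, neg_mul]
    field_simp
    ring
  have h3 : ‖∫ u in (0 : ℝ)..t, Complex.exp (-s * u)‖ ≤
      ∫ u in (0 : ℝ)..t, Real.exp (-s.re * u) := by
    refine (intervalIntegral.norm_integral_le_integral_norm ht).trans_eq ?_
    simp [Complex.norm_exp]
  rw [h1, norm_mul, div_mul_eq_mul_div, mul_div_assoc]
  exact mul_le_mul_of_nonneg_left (h3.trans_eq h2) (norm_nonneg _)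

theorem prodLst_nonneg (n : ℕ) : 0 ≤ prodLst a F σ n :=
  Finset.prod_nonneg fun _ _ => rlst_nonneg F _

theorem prodLst_succ (n : ℕ) :
    prodLst a F σ (n + 1) = prodLst a F σ n * rlst F (σ / (1 + a) ^ n) :=
  Finset.prod_range_succ _ _

theorem ne_div_pow (ha : 0 < a) (hs : ∀ j : ℕ, s ≠ μ * (1 + a) ^ (j + 1)) (j : ℕ) :
    s / (1 + (a : ℂ)) ^ j ≠ μ * (1 + a) := by
  intro h
  rw [div_eq_iff (pow_ne_zero _ (one_add_ofReal_ne_zero ha))] at h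
  exact hs j (by rw [h]; ring)

/-- Partial products of the rational factors of `J` decay geometrically. -/
theorem exists_norm_prod_le (ha : 0 < a) (hμ : 0 < μ)
    (hs : ∀ j : ℕ, s ≠ μ * (1 + a) ^ (j + 1)) :
    ∃ K : ℝ, 0 ≤ K ∧ ∀ n, ‖∏ j ∈ Finset.range n,
      ((μ : ℂ) / (μ * (1 + a) - s / (1 + a) ^ j))‖ ≤ K * ((1 + a) ^ n)⁻¹ := by
  have hb : (0 : ℝ) < 1 + a := by linarith
  have hbc := one_add_ofReal_ne_zero ha
  have hμc : (μ : ℂ) ≠ 0 := by exact_mod_cast hμ.ne'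
  -- Each rational factor equals (1 + e_j)/(1 + a). The e_j are summable, since s/(1+a)^j decays
  -- geometrically, so the product of the 1 + e_j is bounded.
  obtain ⟨e, he⟩ : ∃ e : ℕ → ℂ, e = fun j => s / (1 + a) ^ j *
    (μ * (1 + a) - s / (1 + a) ^ j)⁻¹ := ⟨_, rfl⟩
  have hw : (fun j : ℕ => s / (1 + (a : ℂ)) ^ j) =O[atTop] fun j : ℕ => ((1 + a)⁻¹) ^ j := by
    refine Asymptotics.IsBigO.of_bound ‖s‖ (Eventually.of_forall fun j => ?_)
    rw [norm_div, norm_pow, norm_one_add_ofReal ha, norm_pow, Real.norm_of_nonneg (by positivity),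
      inv_pow, div_eq_mul_inv]
  have hgeom : Summable fun j : ℕ => ((1 + a)⁻¹) ^ j :=
    summable_geometric_of_lt_one (by positivity) (inv_lt_one_of_one_lt₀ (by linarith))
  have hw0 : Tendsto (fun j : ℕ => s / (1 + (a : ℂ)) ^ j) atTop (𝓝 0) :=
    hw.trans_tendsto hgeom.tendsto_atTop_zero
  have hsum : Summable fun j => ‖e j‖ := by
    have h1 : Tendsto (fun j : ℕ => (μ * (1 + a) - s / (1 + (a : ℂ)) ^ j)⁻¹) atTop
        (𝓝 (μ * (1 + a) - 0)⁻¹) :=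
      (tendsto_const_nhds.sub hw0).inv₀ (by simp [hμc, hbc])
    have h2 := hw.mul (h1.isBigO_one ℝ)
    simp only [mul_one] at h2
    rw [he]
    exact (summable_of_isBigO_nat hgeom h2).norm
  refine ⟨Real.exp (∑' j, ‖e j‖), (Real.exp_pos _).le, fun n => ?_⟩
  have hfac : ∀ j : ℕ, ‖(μ : ℂ) / (μ * (1 + a) - s / (1 + a) ^ j)‖ ≤
      Real.exp ‖e j‖ * (1 + a)⁻¹ := fun j => by
    have hd : (μ : ℂ) * (1 + a) - s / (1 + a) ^ j ≠ 0 :=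
      sub_ne_zero.mpr (ne_div_pow ha hs j).symm
    have h1 : (μ : ℂ) / (μ * (1 + a) - s / (1 + a) ^ j) = (1 + e j) * (1 + (a : ℂ))⁻¹ := by
      simp only [he]
      generalize s / (1 + (a : ℂ)) ^ j = w at hd ⊢
      field_simp
      ring
    rw [h1, norm_mul, norm_inv, norm_one_add_ofReal ha]
    refine mul_le_mul_of_nonneg_right ?_ (by positivity)
    refine (norm_add_le _ _).trans ?_
    rw [norm_one, add_comm]
    exact Real.add_one_le_exp _
  rw [norm_prod]
  refine (Finset.prod_le_prod (fun _ _ => norm_nonneg _) fun j _ => hfac j).trans ?_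
  rw [Finset.prod_mul_distrib, Finset.prod_const, Finset.card_range, inv_pow, ← Real.exp_sum]
  gcongr
  exact hsum.sum_le_tsum _ fun _ _ => norm_nonneg _

theorem exists_norm_prodJ_le (ha : 0 < a) (hμ : 0 < μ)
    (hs : ∀ j : ℕ, s ≠ μ * (1 + a) ^ (j + 1)) :
    ∃ K : ℝ, 0 ≤ K ∧ ∀ n, ‖prodJ a μ F s n‖ ≤ K * ((1 + a) ^ n)⁻¹ * prodLst a F s.re n := by
  obtain ⟨K, hK0, hK⟩ := exists_norm_prod_le ha hμ hs
  refine ⟨K, hK0, fun n => ?_⟩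
  unfold prodJ J
  rw [Finset.prod_mul_distrib, norm_mul, mul_comm]
  refine mul_le_mul (hK n) ?_ (norm_nonneg _) (by positivity)
  rw [norm_prod]
  refine Finset.prod_le_prod (fun _ _ => norm_nonneg _) fun j _ => ?_
  rw [← re_div_pow]
  exact norm_lst_le F _

theorem prodJ_succ (n : ℕ) :
    prodJ a μ F s (n + 1) = prodJ a μ F s n * J a μ F (s / (1 + a) ^ n) :=
  Finset.prod_range_succ _ _

/-- The coefficient of `r` in a term is the next product of `J`, so the two parts of the series can
be summed separately. -/
theorem term_eq (r : ℂ) (k : ℕ) :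
    term a μ F r s k = prodJ a μ F s k * ((1 - lst F (s / (1 + a) ^ k)) / (s / (1 + a) ^ k)) -
      prodJ a μ F s (k + 1) * r := by
  rw [prodJ_succ, term, H, J]
  ring

variable [IsProbabilityMeasure F]

theorem norm_one_sub_lst_le (hF : ∀ᵐ t ∂F, 0 < t) (hs : 0 < s.re) :
    ‖1 - lst F s‖ ≤ ‖s‖ / s.re * (1 - rlst F s.re) := by
  have h1 : 1 - lst F s = ∫ t, (1 - Complex.exp (-s * t)) ∂F := by
    rw [integral_sub (integrable_const _) (integrable_cexp hF hs)]
    simp [lst]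
  have h2 : 1 - rlst F s.re = ∫ t, (1 - Real.exp (-(s.re * t))) ∂F := by
    rw [integral_sub (integrable_const _) (integrable_exp_neg hF hs.le)]
    simp [rlst]
  rw [h1, h2, ← integral_const_mul]
  refine norm_integral_le_of_norm_le
    (((integrable_const _).sub (integrable_exp_neg hF hs.le)).const_mul _) ?_
  filter_upwards [hF] with t ht
  exact norm_one_sub_cexp_le hs ht.le

theorem antitone_prodLst (ha : 0 < a) (hF : ∀ᵐ t ∂F, 0 < t) (hσ : 0 ≤ σ) :
    Antitone (prodLst a F σ) := antitone_nat_of_succ_le fun n => by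
  rw [prodLst_succ]
  exact mul_le_of_le_one_right (prodLst_nonneg n) (rlst_le_one hF (by positivity))

theorem prodLst_le_one (ha : 0 < a) (hF : ∀ᵐ t ∂F, 0 < t) (hσ : 0 ≤ σ) (n : ℕ) :
    prodLst a F σ n ≤ 1 :=
  (antitone_prodLst ha hF hσ (Nat.zero_le n)).trans_eq (by simp [prodLst])

/-- A telescoping sum of nonnegative differences, bounded by the empty product `1`. -/
theorem summable_prodLst_sub (ha : 0 < a) (hF : ∀ᵐ t ∂F, 0 < t) (hσ : 0 ≤ σ) :
    Summable fun n => prodLst a F σ n - prodLst a F σ (n + 1) := by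
  refine summable_of_sum_range_le (c := 1)
    (fun n => sub_nonneg.mpr (antitone_prodLst ha hF hσ n.le_succ)) fun n => ?_
  rw [Finset.sum_range_sub']
  have : prodLst a F σ 0 = 1 := by simp [prodLst]
  rw [this]
  linarith [prodLst_nonneg (a := a) (F := F) (σ := σ) n]

theorem summable_prodJ (ha : 0 < a) (hμ : 0 < μ) (hF : ∀ᵐ t ∂F, 0 < t) (hs0 : 0 < s.re)
    (hs : ∀ j : ℕ, s ≠ μ * (1 + a) ^ (j + 1)) : Summable (prodJ a μ F s) := by
  obtain ⟨K, hK0, hK⟩ := exists_norm_prodJ_le (F := F) ha hμ hs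
  have hgeom : Summable fun j : ℕ => ((1 + a)⁻¹) ^ j :=
    summable_geometric_of_lt_one (by positivity) (inv_lt_one_of_one_lt₀ (by linarith))
  refine Summable.of_norm_bounded (hgeom.mul_left K) fun n => (hK n).trans ?_
  rw [inv_pow]
  exact mul_le_of_le_one_right (by positivity) (prodLst_le_one ha hF hs0.le n)

/-- Division by s/(1+a)^k cancels the geometric decay of the product of `J`. What remains is a
multiple of Q_k (1 - φ(σ_k)) = Q_k - Q_{k+1}, which telescopes. -/
theorem summable_prodJ_mul (ha : 0 < a) (hμ : 0 < μ) (hF : ∀ᵐ t ∂F, 0 < t) (hs0 : 0 < s.re)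
    (hs : ∀ j : ℕ, s ≠ μ * (1 + a) ^ (j + 1)) :
    Summable fun k : ℕ =>
      prodJ a μ F s k * ((1 - lst F (s / (1 + a) ^ k)) / (s / (1 + a) ^ k)) := by
  obtain ⟨K, hK0, hK⟩ := exists_norm_prodJ_le (F := F) ha hμ hs
  refine Summable.of_norm_bounded ((summable_prodLst_sub ha hF hs0.le).mul_left (K / s.re))
    fun n => ?_
  have hpos := re_div_pow_pos ha hs0 n
  have h1 := norm_one_sub_lst_le hF hpos
  have hw : 0 < ‖s / (1 + (a : ℂ)) ^ n‖ := norm_pos_iff.mpr fun h => by simp [h] at hpos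
  rw [norm_mul, norm_div]
  calc _ ≤ K * ((1 + a) ^ n)⁻¹ * prodLst a F s.re n *
        (1 / (s.re / (1 + a) ^ n) * (1 - rlst F (s.re / (1 + a) ^ n))) := by
        refine mul_le_mul (hK n) ?_ (by positivity)
          (mul_nonneg (by positivity) (prodLst_nonneg n))
        rw [div_le_iff₀ hw, ← re_div_pow]
        refine h1.trans_eq ?_
        field_simp
    _ = _ := by
        rw [prodLst_succ]
        field_simp

theorem summable_term (ha : 0 < a) (hμ : 0 < μ) (hF : ∀ᵐ t ∂F, 0 < t) (hs0 : 0 < s.re)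
    (hs : ∀ j : ℕ, s ≠ μ * (1 + a) ^ (j + 1)) (r : ℂ) : Summable (term a μ F r s) := by
  have h1 := summable_prodJ_mul ha hμ hF hs0 hs
  have h2 := ((summable_nat_add_iff 1).mpr (summable_prodJ ha hμ hF hs0 hs)).mul_right r
  exact (h1.sub h2).congr fun k => (term_eq r k).symm

end Series

/-! ### Abelian limit and continuity of the Laplace transform -/

section Abel

theorem norm_laplace_le {R : ℝ → ℝ} (hR0 : ∀ x, 0 ≤ R x) (s : ℂ) :
    ‖laplace R s‖ ≤ ∫ x in Ioi (0 : ℝ), Real.exp (-s.re * x) * R x := by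
  refine (norm_integral_le_integral_norm _).trans_eq ?_
  congr 1
  ext x
  rw [norm_mul, Complex.norm_exp, Complex.norm_real, Real.norm_of_nonneg (hR0 x)]
  simp

theorem integrableOn_rexp_mul {R : ℝ → ℝ} (hR : Measurable R) (hR0 : ∀ x, 0 ≤ R x)
    (hR1 : ∀ x, R x ≤ 1) {σ : ℝ} (hσ : 0 < σ) :
    IntegrableOn (fun x => Real.exp (-σ * x) * R x) (Ioi 0) :=
  Integrable.mul_bdd (c := 1) (integrableOn_exp_mul_Ioi (neg_lt_zero.mpr hσ) 0)
    hR.aestronglyMeasurable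
    (ae_of_all _ fun x => by rw [Real.norm_of_nonneg (hR0 x)]; exact hR1 x)

theorem mul_integral_rexp {σ : ℝ} (hσ : 0 < σ) :
    σ * ∫ x in Ioi (0 : ℝ), Real.exp (-σ * x) = 1 := by
  rw [integral_exp_mul_Ioi (neg_lt_zero.mpr hσ)]
  simp [hσ.ne']

theorem mul_integral_rexp_mul_le_one {R : ℝ → ℝ} (hR : Measurable R) (hR0 : ∀ x, 0 ≤ R x)
    (hR1 : ∀ x, R x ≤ 1) {σ : ℝ} (hσ : 0 < σ) :
    σ * ∫ x in Ioi (0 : ℝ), Real.exp (-σ * x) * R x ≤ 1 := by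
  rw [← mul_integral_rexp hσ]
  refine mul_le_mul_of_nonneg_left ?_ hσ.le
  refine integral_mono (integrableOn_rexp_mul hR hR0 hR1 hσ)
    (integrableOn_exp_mul_Ioi (neg_lt_zero.mpr hσ) 0) fun x => ?_
  exact mul_le_of_le_one_right (Real.exp_pos _).le (hR1 x)

/-- An Abelian theorem for the Laplace transform of a function vanishing at infinity. -/
theorem tendsto_mul_integral_rexp_mul {R : ℝ → ℝ} (hR : Measurable R) (hR0 : ∀ x, 0 ≤ R x)
    (hR1 : ∀ x, R x ≤ 1) (hlim : Tendsto R atTop (𝓝 0)) :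
    Tendsto (fun σ : ℝ => σ * ∫ x in Ioi (0 : ℝ), Real.exp (-σ * x) * R x) (𝓝[>] 0) (𝓝 0) := by
  rw [Metric.tendsto_nhds]
  intro η hη
  obtain ⟨X, hX⟩ := (hlim.eventually (gt_mem_nhds (half_pos hη))).exists_forall_of_atTop
  set Y := max X 1
  have hY : 0 < Y := lt_max_of_lt_right one_pos
  have hev : ∀ᶠ σ : ℝ in 𝓝[>] 0, σ < η / 2 / Y :=
    nhdsWithin_le_nhds (gt_mem_nhds (by positivity))
  filter_upwards [hev, self_mem_nhdsWithin] with σ h1 (h2 : 0 < σ)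
  have hnn : 0 ≤ σ * ∫ x in Ioi (0 : ℝ), Real.exp (-σ * x) * R x :=
    mul_nonneg h2.le (integral_nonneg fun x => mul_nonneg (Real.exp_pos _).le (hR0 x))
  rw [Real.dist_eq, sub_zero, abs_of_nonneg hnn]
  have i1 : IntegrableOn ((Ioc 0 Y).indicator fun _ => (1 : ℝ)) (Ioi 0) :=
    ((integrable_indicator_iff measurableSet_Ioc).mpr (by simp)).integrableOn
  have i2 : IntegrableOn (fun x => η / 2 * Real.exp (-σ * x)) (Ioi 0) :=
    (integrableOn_exp_mul_Ioi (neg_lt_zero.mpr h2) 0).const_mul _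
  -- The integrand is at most `1` up to `Y` and at most `η / 2` times the exponential beyond it;
  -- after multiplication by σ the first part contributes σ Y < η / 2.
  have h3 : ∫ x in Ioi (0 : ℝ), Real.exp (-σ * x) * R x ≤
      ∫ x in Ioi (0 : ℝ), ((Ioc 0 Y).indicator (fun _ => (1 : ℝ)) x +
        η / 2 * Real.exp (-σ * x)) := by
    refine setIntegral_mono_on (integrableOn_rexp_mul hR hR0 hR1 h2) (i1.add i2)
      measurableSet_Ioi fun x (hx : 0 < x) => ?_
    have hexp := Real.exp_pos (-σ * x)
    by_cases hxY : x ≤ Y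
    · rw [indicator_of_mem (show x ∈ Ioc 0 Y from ⟨hx, hxY⟩)]
      have : Real.exp (-σ * x) ≤ 1 := by
        rw [Real.exp_le_one_iff, neg_mul, neg_nonpos]
        positivity
      have := mul_le_one₀ this (hR0 x) (hR1 x)
      have : 0 ≤ η / 2 * Real.exp (-σ * x) := by positivity
      linarith
    · rw [indicator_of_notMem (show x ∉ Ioc 0 Y from fun h => hxY h.2), zero_add, mul_comm]
      exact mul_le_mul_of_nonneg_right (hX x ((le_max_left _ _).trans (not_le.mp hxY).le)).le
        hexp.le
  have h4 : ∫ x in Ioi (0 : ℝ), (Ioc 0 Y).indicator (fun _ => (1 : ℝ)) x = Y := by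
    rw [setIntegral_indicator measurableSet_Ioc, inter_eq_right.mpr Ioc_subset_Ioi_self]
    simp [hY.le]
  rw [integral_add i1 i2, h4, integral_const_mul] at h3
  calc _ ≤ σ * (Y + η / 2 * ∫ x in Ioi (0 : ℝ), Real.exp (-σ * x)) :=
        mul_le_mul_of_nonneg_left h3 h2.le
    _ = σ * Y + η / 2 * (σ * ∫ x in Ioi (0 : ℝ), Real.exp (-σ * x)) := by ring
    _ < η := by
        rw [mul_integral_rexp h2]
        rw [lt_div_iff₀ hY] at h1
        linarith

theorem continuousAt_laplace {R : ℝ → ℝ} (hR : Measurable R) {K : ℝ}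
    (hK : ∀ x, |R x| ≤ K) {s : ℂ} (hs : 0 < s.re) : ContinuousAt (laplace R) s := by
  have hK0 : 0 ≤ K := (abs_nonneg _).trans (hK 0)
  refine continuousAt_of_dominated (bound := fun x => K * Real.exp (-(s.re / 2) * x)) ?_ ?_ ?_ ?_
  · exact Eventually.of_forall fun w => Measurable.aestronglyMeasurable (by fun_prop)
  · have : ∀ᶠ w : ℂ in 𝓝 s, s.re / 2 < w.re :=
      Complex.continuous_re.continuousAt.eventually (lt_mem_nhds (by linarith))
    filter_upwards [this] with w hw
    filter_upwards [ae_restrict_mem measurableSet_Ioi] with x (hx : 0 < x)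
    rw [norm_mul, mul_comm, Complex.norm_exp, Complex.norm_real]
    refine mul_le_mul (hK x) ?_ (Real.exp_pos _).le hK0
    rw [Real.exp_le_exp]
    simp only [Complex.mul_re, Complex.neg_re, Complex.ofReal_re, Complex.neg_im,
      Complex.ofReal_im, mul_zero, sub_zero]
    exact mul_le_mul_of_nonneg_right (by linarith) hx.le
  · exact (integrableOn_exp_mul_Ioi (by linarith) 0).const_mul K
  · exact ae_of_all _ fun x => by fun_prop

end Abel

/-! ### Iteration and vanishing of the remainder -/

section Representation

variable {a μ : ℝ} {F : Measure ℝ} [IsProbabilityMeasure F] {s : ℂ}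

/-- Iteration of the functional equation. -/
theorem laplace_ruinFun_eq_sum (ha : 0 < a) (hμ : 0 < μ) (hF : ∀ᵐ t ∂F, 0 < t) (hs0 : 0 < s.re)
    (hs : ∀ j : ℕ, s ≠ μ * (1 + a) ^ (j + 1)) (n : ℕ) :
    laplace (ruinFun a F (expMeasure μ)) s =
      ∑ k ∈ Finset.range n, term a μ F (laplace (ruinFun a F (expMeasure μ)) μ) s k +
        prodJ a μ F s n * laplace (ruinFun a F (expMeasure μ)) (s / (1 + a) ^ n) := by
  induction n with
  | zero => simp [prodJ]
  | succ n ih =>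
    rw [ih, laplace_ruinFun_eq ha hμ hF (re_div_pow_pos ha hs0 n) (ne_div_pow ha hs n),
      Finset.sum_range_succ, prodJ_succ, term, div_div, ← pow_succ]
    ring

/-- The remainder of the iteration vanishes. -/
theorem tendsto_prodJ_mul_laplace (ha : 0 < a) (hμ : 0 < μ) (hF : ∀ᵐ t ∂F, 0 < t)
    (hs0 : 0 < s.re) (hs : ∀ j : ℕ, s ≠ μ * (1 + a) ^ (j + 1)) :
    Tendsto (fun n => prodJ a μ F s n *
      laplace (ruinFun a F (expMeasure μ)) (s / (1 + a) ^ n)) atTop (𝓝 0) := by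
  have := isProbabilityMeasure_expMeasure hμ
  set R := ruinFun a F (expMeasure μ) with hRdef
  have hR : Measurable R := measurable_ruinFun ha
  have hR0 : ∀ x, 0 ≤ R x := fun x => ruinFun_nonneg x
  have hR1 : ∀ x, R x ≤ 1 := fun x => ruinFun_le_one x
  obtain ⟨K, hK0, hK⟩ := exists_norm_prodJ_le (F := F) ha hμ hs
  let v : ℝ → ℝ := fun σ => σ * ∫ x in Ioi (0 : ℝ), Real.exp (-σ * x) * R x
  have hσ : ∀ n : ℕ, 0 < s.re / (1 + a) ^ n := fun n => by positivity
  have hv0 : ∀ n : ℕ, 0 ≤ v (s.re / (1 + a) ^ n) := fun n =>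
    mul_nonneg (hσ n).le (integral_nonneg fun x => mul_nonneg (Real.exp_pos _).le (hR0 x))
  have hv1 : ∀ n : ℕ, v (s.re / (1 + a) ^ n) ≤ 1 := fun n =>
    mul_integral_rexp_mul_le_one hR hR0 hR1 (hσ n)
  have hbound : ∀ n, ‖prodJ a μ F s n * laplace R (s / (1 + a) ^ n)‖ ≤
      K / s.re * (prodLst a F s.re n * v (s.re / (1 + a) ^ n)) := fun n => by
    have h1 := norm_laplace_le hR0 (s / (1 + (a : ℂ)) ^ n)
    rw [re_div_pow] at h1
    rw [norm_mul]
    refine (mul_le_mul (hK n) h1 (norm_nonneg _)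
      (mul_nonneg (by positivity) (prodLst_nonneg n))).trans_eq ?_
    simp only [v]
    field_simp
  suffices h : Tendsto (fun n => prodLst a F s.re n * v (s.re / (1 + a) ^ n)) atTop (𝓝 0) by
    refine squeeze_zero_norm hbound ?_
    simpa using h.const_mul (K / s.re)
  have hlim := tendsto_atTop_ciInf (antitone_prodLst ha hF hs0.le)
    ⟨0, by rintro _ ⟨n, rfl⟩; exact prodLst_nonneg n⟩
  set p := ⨅ n, prodLst a F s.re n
  have hp0 : 0 ≤ p := ge_of_tendsto' hlim fun n => prodLst_nonneg n
  -- If the product of the transforms tends to zero, boundedness of `v` suffices; otherwise its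
  -- positive limit forces `R`, and hence `v`, to zero.
  rcases hp0.eq_or_lt with hp | hp
  · rw [← hp] at hlim
    exact squeeze_zero (fun n => mul_nonneg (prodLst_nonneg n) (hv0 n))
      (fun n => mul_le_of_le_one_right (prodLst_nonneg n) (hv1 n)) hlim
  · have hR_lim : Tendsto R atTop (𝓝 0) :=
      tendsto_ruinFun ha hF (ae_expMeasure_nonneg μ) hs0 hp hlim
    have hσ_lim : Tendsto (fun n : ℕ => s.re / (1 + a) ^ n) atTop (𝓝[>] 0) :=
      tendsto_nhdsWithin_iff.mpr
        ⟨tendsto_const_nhds.div_atTop (tendsto_pow_atTop_atTop_of_one_lt (by linarith)),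
          Eventually.of_forall hσ⟩
    have hv := (tendsto_mul_integral_rexp_mul hR hR0 hR1 hR_lim).comp hσ_lim
    exact squeeze_zero (fun n => mul_nonneg (prodLst_nonneg n) (hv0 n))
      (fun n => mul_le_of_le_one_left (hv0 n) (prodLst_le_one ha hF hs0.le n)) hv

theorem hasSum_term (ha : 0 < a) (hμ : 0 < μ) (hF : ∀ᵐ t ∂F, 0 < t) (hs0 : 0 < s.re)
    (hs : ∀ j : ℕ, s ≠ μ * (1 + a) ^ (j + 1)) :
    HasSum (term a μ F (laplace (ruinFun a F (expMeasure μ)) μ) s)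
      (laplace (ruinFun a F (expMeasure μ)) s) := by
  rw [(summable_term ha hμ hF hs0 hs _).hasSum_iff_tendsto_nat]
  have h := (tendsto_prodJ_mul_laplace ha hμ hF hs0 hs).const_sub
    (laplace (ruinFun a F (expMeasure μ)) s)
  rw [sub_zero] at h
  refine h.congr fun n => ?_
  nth_rewrite 1 [laplace_ruinFun_eq_sum ha hμ hF hs0 hs n]
  ring

end Representation

/-- The points `μ (1 + a)^(j + 1)` form a discrete set. -/
theorem eventually_ne_pole {a μ : ℝ} (ha : 0 < a) (hμ : 0 < μ) (j : ℕ) :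
    ∀ᶠ s : ℂ in 𝓝[≠] ((μ : ℂ) * (1 + a) ^ (j + 1)),
      ∀ i : ℕ, s ≠ μ * (1 + a) ^ (i + 1) := by
  have hbig : Tendsto (fun i : ℕ => μ * (1 + a) ^ (i + 1)) atTop atTop :=
    ((tendsto_pow_atTop_atTop_of_one_lt (by linarith)).comp
      (tendsto_add_atTop_nat 1)).const_mul_atTop hμ
  set s₀ := (μ : ℂ) * (1 + a) ^ (j + 1)
  -- From index `N` on the points lie outside the open ball of radius `‖s₀‖ + 1` about the origin,
  -- so only finitely many need to be avoided.
  obtain ⟨N, hN⟩ := (hbig.eventually (eventually_ge_atTop (‖s₀‖ + 1))).exists_forall_of_atTop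
  have h1 : ∀ᶠ s : ℂ in 𝓝[≠] s₀, ‖s‖ < ‖s₀‖ + 1 :=
    nhdsWithin_le_nhds (continuous_norm.continuousAt.eventually (gt_mem_nhds (by linarith)))
  have h2 : ∀ᶠ s : ℂ in 𝓝[≠] s₀, ∀ i ∈ Finset.range N, s ≠ μ * (1 + a) ^ (i + 1) := by
    rw [Filter.eventually_all_finset]
    intro i _
    by_cases hi : (μ : ℂ) * (1 + a) ^ (i + 1) = s₀
    · rw [hi]
      exact self_mem_nhdsWithin
    · exact nhdsWithin_le_nhds (isOpen_ne.mem_nhds (Ne.symm hi))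
  filter_upwards [h1, h2] with s hs1 hs2 i hi
  rcases lt_or_ge i N with h | h
  · exact hs2 i (Finset.mem_range.mpr h) hi
  · have h3 := hN i h
    have h4 : ‖s‖ = μ * (1 + a) ^ (i + 1) := by
      rw [hi, norm_mul, norm_pow, norm_one_add_ofReal ha, Complex.norm_real,
        Real.norm_of_nonneg hμ.le]
    linarith

/-! ### The value at μ -/

section Constant

variable {a μ : ℝ} {F : Measure ℝ}

theorem ofReal_ne_pole (ha : 0 < a) (hμ : 0 < μ) (j : ℕ) :
    (μ : ℂ) ≠ μ * (1 + a) ^ (j + 1) := by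
  intro h
  have h1 : μ = μ * (1 + a) ^ (j + 1) := by exact_mod_cast h
  have h2 : 1 < (1 + a) ^ (j + 1) := one_lt_pow₀ (by linarith) (by omega)
  nlinarith

/-- At s = μ the rational factor of `J` with index `k` simplifies to (1+a)^k / ((1+a)^(k+1) - 1). -/
theorem denTerm_eq (ha : 0 < a) (hμ : 0 < μ) (k : ℕ) :
    denTerm a μ F k = prodJ a μ F μ (k + 1) := by
  have hbc := one_add_ofReal_ne_zero ha
  have hμc : (μ : ℂ) ≠ 0 := by exact_mod_cast hμ.ne'
  have hd := sub_ne_zero.mpr (ne_div_pow ha (ofReal_ne_pole ha hμ) k).symm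
  have hd' : (1 + (a : ℂ)) ^ (k + 1) - 1 ≠ 0 := by
    intro h
    apply hd
    have : (μ : ℂ) * (1 + a) - μ / (1 + a) ^ k =
        μ / (1 + a) ^ k * ((1 + a) ^ (k + 1) - 1) := by
      field_simp
      ring
    rw [this, h, mul_zero]
  rw [prodJ_succ, denTerm, J]
  congr 2
  rw [div_eq_div_iff hd' hd]
  field_simp
  ring

theorem prodJ_ofReal (a μ : ℝ) (F : Measure ℝ) (n : ℕ) :
    prodJ a μ F μ n = ((∏ j ∈ Finset.range n, rlst F (μ / (1 + a) ^ j) *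
      (μ / (μ * (1 + a) - μ / (1 + a) ^ j)) : ℝ) : ℂ) := by
  rw [prodJ, Complex.ofReal_prod]
  refine Finset.prod_congr rfl fun j _ => ?_
  have : (μ : ℂ) / (1 + a) ^ j = ((μ / (1 + a) ^ j : ℝ) : ℂ) := by push_cast; rfl
  rw [J, this, lst_ofReal]
  push_cast
  rfl

/-- At μ every factor of `J` is real and nonnegative, because μ/(1+a)^j ≤ μ(1+a); hence the sum is
at least `1`. -/
theorem one_add_tsum_denTerm_ne_zero (ha : 0 < a) (hμ : 0 < μ) :
    1 + ∑' k, denTerm a μ F k ≠ 0 := by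
  simp only [denTerm_eq ha hμ, prodJ_ofReal]
  rw [← Complex.ofReal_tsum, ← Complex.ofReal_one, ← Complex.ofReal_add, Complex.ofReal_ne_zero]
  refine (add_pos_of_pos_of_nonneg one_pos (tsum_nonneg fun k => Finset.prod_nonneg
    fun j _ => mul_nonneg (rlst_nonneg F _) (div_nonneg hμ.le ?_))).ne'
  rw [sub_nonneg]
  calc μ / (1 + a) ^ j ≤ μ := div_le_self hμ.le (one_le_pow₀ (by linarith))
    _ ≤ μ * (1 + a) := by nlinarith

end Constant

end DualRisk

theorem theorem1 {Ω : Type*} [MeasurableSpace Ω] (P : Measure Ω) [IsProbabilityMeasure P]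
    (a μ : ℝ) (ha : 0 < a) (hμ : 0 < μ)
    (F : Measure ℝ) (hF : F (Iic 0) = 0)
    (A C : ℕ → Ω → ℝ)
    (hA : ∀ i, HasLaw (A i) F P)
    (hC : ∀ i, HasLaw (C i) (expMeasure μ) P)
    (hAC : iIndepFun (Sum.elim A C) P)
    (ρ : ℂ → ℂ) (hρ : ρ = DualRisk.laplace (DualRisk.ruinProb P a A C)) :
    -- the Laplace integral converges absolutely in the open right half-plane
    (∀ s : ℂ, 0 < s.re → IntegrableOn
      (fun x : ℝ => Complex.exp (-s * x) * (DualRisk.ruinProb P a A C x : ℂ)) (Ioi 0)) ∧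
    -- the series representation, off the poles `μ (1 + a) ^ (j + 1)` of its terms
    (∀ s : ℂ, 0 < s.re → (∀ j : ℕ, s ≠ μ * (1 + a) ^ (j + 1)) →
      HasSum (DualRisk.term a μ F (ρ μ) s) (ρ s)) ∧
    -- these poles are removable singularities of the sum, which extends by the value of `ρ`
    (∀ j : ℕ, Tendsto (fun s : ℂ => ∑' k, DualRisk.term a μ F (ρ μ) s k)
      (𝓝[≠] ((μ : ℂ) * (1 + a) ^ (j + 1))) (𝓝 (ρ (μ * (1 + a) ^ (j + 1))))) ∧
    -- the constant `ρ μ`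
    Summable (DualRisk.numTerm a μ F) ∧ Summable (DualRisk.denTerm a μ F) ∧
    1 + ∑' k, DualRisk.denTerm a μ F k ≠ 0 ∧
    ρ μ = (∑' k, DualRisk.numTerm a μ F k) / (1 + ∑' k, DualRisk.denTerm a μ F k) := by
  have := (hA 0).isProbabilityMeasure_iff.mp inferInstance
  have := isProbabilityMeasure_expMeasure hμ
  have hF' : ∀ᵐ t ∂F, 0 < t := by
    rw [ae_iff]
    simp only [not_lt]
    exact hF
  obtain ⟨R, hR⟩ : ∃ R, R = DualRisk.ruinFun a F (expMeasure μ) := ⟨_, rfl⟩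
  have hRm : Measurable R := hR ▸ DualRisk.measurable_ruinFun ha
  have hRK : ∀ x, |R x| ≤ 1 := fun x => by
    rw [hR, abs_of_nonneg (DualRisk.ruinFun_nonneg x)]
    exact DualRisk.ruinFun_le_one x
  -- Agreement for x > 0 is enough, since the Laplace integral sees only that half-line;
  -- measurability and bounds are then taken from `R`.
  have hruin : ∀ x : ℝ, 0 < x → DualRisk.ruinProb P a A C x = R x := fun x hx =>
    hR ▸ DualRisk.ruinProb_eq ha hF' (DualRisk.ae_expMeasure_nonneg μ) hA hC hAC hx
  have hρR : ρ = DualRisk.laplace R := by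
    rw [hρ]
    ext s
    refine setIntegral_congr_fun measurableSet_Ioi fun x hx => ?_
    simp only [hruin x hx]
  have hsum : ∀ s : ℂ, 0 < s.re → (∀ j : ℕ, s ≠ μ * (1 + a) ^ (j + 1)) →
      HasSum (DualRisk.term a μ F (ρ μ) s) (ρ s) := fun s hs0 hs => by
    rw [hρR, hR]
    exact DualRisk.hasSum_term ha hμ hF' hs0 hs
  have hμre : 0 < (μ : ℂ).re := by simpa using hμ
  have hnum : Summable (DualRisk.numTerm a μ F) :=
    DualRisk.summable_prodJ_mul ha hμ hF' hμre (DualRisk.ofReal_ne_pole ha hμ)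
  have hden : Summable (DualRisk.denTerm a μ F) :=
    ((summable_nat_add_iff 1).mpr (DualRisk.summable_prodJ ha hμ hF' hμre
      (DualRisk.ofReal_ne_pole ha hμ))).congr fun k => (DualRisk.denTerm_eq ha hμ k).symm
  have hne := DualRisk.one_add_tsum_denTerm_ne_zero (F := F) ha hμ
  refine ⟨fun s hs => ?_, hsum, fun j => ?_, hnum, hden, hne, ?_⟩
  · refine (DualRisk.integrableOn_exp_mul_bounded hRm hRK hs).congr_fun (fun x hx => ?_)
      measurableSet_Ioi
    simp only [hruin x hx]
  · have hre : 0 < ((μ : ℂ) * (1 + a) ^ (j + 1)).re := by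
      have : (μ : ℂ) * (1 + a) ^ (j + 1) = ((μ * (1 + a) ^ (j + 1) : ℝ) : ℂ) := by push_cast; rfl
      rw [this, Complex.ofReal_re]
      positivity
    have hcont : ContinuousAt ρ ((μ : ℂ) * (1 + a) ^ (j + 1)) :=
      hρR ▸ DualRisk.continuousAt_laplace hRm hRK hre
    refine (hcont.tendsto.mono_left nhdsWithin_le_nhds).congr' ?_
    filter_upwards [DualRisk.eventually_ne_pole ha hμ j, nhdsWithin_le_nhds
      (Complex.continuous_re.continuousAt.eventually (lt_mem_nhds hre))] with s hs hs0
    exact (hsum s hs0 hs).tsum_eq.symm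
  -- The representation at s = μ contains ρ(μ) on both sides, linearly; the two summable parts are
  -- separated and the equation is solved for it.
  · have h1 := (hsum μ hμre (DualRisk.ofReal_ne_pole ha hμ)).tsum_eq
    have h2 : ∀ k, DualRisk.term a μ F (ρ μ) μ k =
        DualRisk.numTerm a μ F k - DualRisk.denTerm a μ F k * ρ μ := fun k => by
      rw [DualRisk.term_eq, DualRisk.denTerm_eq ha hμ, DualRisk.numTerm]
    rw [tsum_congr h2, hnum.tsum_sub (hden.mul_right _), tsum_mul_right] at h1
    rw [eq_div_iff hne]
    linear_combination -h1
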